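/- \textbf{Theorem (Linear stability).} Let $d\in\{2,3\}$, let $\Omega\subset\mathbb R^d$ be a bounded domain (non-empty, open, connected), let $\epsilon>0$, and let $V_r,V_b\in H^1(\Omega)\cap L^\infty(\Omega)$. Put $\bar\alpha=\epsilon^d\,\frac{2(d-1)\pi}{d}$, $\bar\gamma=\epsilon^d\,\frac{\pi}{d}$, $\mathcal S=\{(r,b)\in\mathbb R^2: r\ge 0,\ b\ge 0,\ r+b\le 1/\bar\gamma\}$, $$E(r,b)=\int_\Omega r\log r+b\log b+rV_r+bV_b+\tfrac{\bar\alpha}{2}(r^2+2rb+b^2)\,dx,$$ $$M(r,b)=\begin{pmatrix} r(1-\bar\gamma b)&\bar\gamma rb\\ \bar\gamma rb& b(1-\bar\gamma r)\end{pmatrix},\qquad u=\log r+\bar\alpha(r+b)+V_r,\quad v=\log b+\bar\alpha(r+b)+V_b .$$ For given masses $N_r,N_b$, a \emph{stationary solution} is a pair of measurable functions $(r,b)$ with $(r,b)\in\mathcal S^\circ$ a.e. in $\Omega$, $\int_\Omega r=N_r$, $\int_\Omega b=N_b$, $u,v\in H^1(\Omega)$, which solves $\nabla\cdot\big(M(r,b)\nabla(u,v)^T\big)=0$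 with no-flux boundary conditions in the weak sense (test functions in $H^1(\Omega)^2$). Write $E^{\star\prime}:(u,v)\mapsto(r,b)$ for the inverse of the map $(r,b)\mapsto(u,v)$ on positive densities (for fixed $x$), and $E^{\star\prime\prime}$ for its Jacobian matrix, the Hessian of the dual entropy. Then: (i) $E$ is strictly convex on the measurable $\mathcal S$-valued pairs (identified up to null sets), and for given masses $N_r,N_b$ there is at most one stationary solution, up to null sets. Let now $(r_\infty,b_\infty)$ be a stationary solution with masses $N_r,N_b$. (ii) Its entropy variables $u_\infty,v_\infty$ are constant a.e., and it is the unique minimizer of $E$ among all measurable $\mathcal S$-valued pairs with masses $N_r,N_b$. (iii) The matrices $E^{\star\prime\prime}(u_\infty,v_\infty)$ and $M(r_\infty,b_\infty)$ are positive definite a.e. in $\Omega$. (iv) If $\lambda\in\mathbb C$ and $0\ne(\xi,\eta)\in H^1(\Omega;\mathbb C)^2$ satisfy $$\lambda\,E^{\star\prime\prime}(u_\infty,v_\infty)\begin{pmatrix}\xi\\ \eta\end{pmatrix}=\nabla\cdot\left(M(r_\infty,b_\infty)\begin{pmatrix}\nabla\xi\\ \nabla\eta\end{pmatrix}\right)$$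 weakly with no-flux boundary conditions, then $\lambda$ is real and $\lambda\le 0$; $\lambda=0$ if and only if $\xi$ and $\eta$ are both constant; and $\lambda<0$ whenever the perturbation preserves the masses, i.e. $\int_\Omega E^{\star\prime\prime}(u_\infty,v_\infty)(\xi,\eta)^T\,dx=0$. (v) The stationary solution is linearly stable: there is a constant $C>0$ such that for every $T>0$ and every weak solution $(\xi,\eta)\in L^2(0,T;H^1(\Omega))^2$ of $$E^{\star\prime\prime}(u_\infty,v_\infty)\,\partial_t\begin{pmatrix}\xi\\ \eta\end{pmatrix}=\nabla\cdot\left(M(r_\infty,b_\infty)\begin{pmatrix}\nabla\xi\\ \nabla\eta\end{pmatrix}\right)$$ with no-flux boundary conditions and initial value $(\xi_0,\eta_0)\in L^2(\Omega)^2$, one has $\|\xi(t)\|_{L^2}^2+\|\eta(t)\|_{L^2}^2\le C\,(\|\xi_0\|_{L^2}^2+\|\eta_0\|_{L^2}^2)$ for a.e. $t\in(0,T)$. -/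

import Mathlib

open MeasureTheory Set
open scoped ContDiff

noncomputable section

namespace HardSpheres

/-! ### The space `H¹(Ω)` through weak derivatives -/

/-- `g = (g₀, …, g_{d-1})` is the weak (distributional) gradient of `f` on `Ω`. -/
def HasWeakGradient {d : ℕ} {𝕜 : Type*} [RCLike 𝕜] (Ω : Set (EuclideanSpace ℝ (Fin d)))
    (f : EuclideanSpace ℝ (Fin d) → 𝕜) (g : Fin d → EuclideanSpace ℝ (Fin d) → 𝕜) : Prop :=
  ∀ (i : Fin d) (φ : EuclideanSpace ℝ (Fin d) → ℝ),
    ContDiff ℝ ∞ φ → HasCompactSupport φ → tsupport φ ⊆ Ω →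
      ∫ x in Ω, fderiv ℝ φ x (EuclideanSpace.single i 1) • f x = - ∫ x in Ω, φ x • g i x

/-- `f ∈ H¹(Ω)` with weak gradient `g`. -/
structure IsH1With {d : ℕ} {𝕜 : Type*} [RCLike 𝕜] (Ω : Set (EuclideanSpace ℝ (Fin d)))
    (f : EuclideanSpace ℝ (Fin d) → 𝕜) (g : Fin d → EuclideanSpace ℝ (Fin d) → 𝕜) : Prop where
  memLp : MemLp f 2 (volume.restrict Ω)
  memLp_grad : ∀ i, MemLp (g i) 2 (volume.restrict Ω)
  weakGradient : HasWeakGradient Ω f g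

/-- `f ∈ H¹(Ω)`. -/
def MemH1 {d : ℕ} {𝕜 : Type*} [RCLike 𝕜] (Ω : Set (EuclideanSpace ℝ (Fin d)))
    (f : EuclideanSpace ℝ (Fin d) → 𝕜) : Prop :=
  ∃ g, IsH1With Ω f g

/-- `f ∈ L²(0,T;H¹(Ω))` with spatial weak gradient `g`. -/
structure IsL2H1With {d : ℕ} (Ω : Set (EuclideanSpace ℝ (Fin d))) (T : ℝ)
    (f : ℝ → EuclideanSpace ℝ (Fin d) → ℝ)
    (g : Fin d → ℝ → EuclideanSpace ℝ (Fin d) → ℝ) : Prop where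
  memLp : MemLp (fun q : ℝ × EuclideanSpace ℝ (Fin d) => f q.1 q.2) 2
    ((volume.restrict (Ioo 0 T)).prod (volume.restrict Ω))
  memLp_grad : ∀ k, MemLp (fun q : ℝ × EuclideanSpace ℝ (Fin d) => g k q.1 q.2) 2
    ((volume.restrict (Ioo 0 T)).prod (volume.restrict Ω))
  isH1With : ∀ᵐ t ∂(volume.restrict (Ioo 0 T)), IsH1With Ω (f t) (fun k => g k t)

/-! ### The model: constants, state set, entropy, mobility -/

/-- `ᾱ = ε^d α` with `α = 2 (d - 1) π / d`. -/
def alphaBar (d : ℕ) (ε : ℝ) : ℝ := ε ^ d * (2 * ((d : ℝ) - 1) * Real.pi / d)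

/-- `γ̄ = ε^d γ` with `γ = π / d`. -/
def gammaBar (d : ℕ) (ε : ℝ) : ℝ := ε ^ d * (Real.pi / d)

/-- The set `𝒮` of admissible densities `(r, b)`. -/
def stateSet (d : ℕ) (ε : ℝ) : Set (ℝ × ℝ) :=
  {p | 0 ≤ p.1 ∧ 0 ≤ p.2 ∧ p.1 + p.2 ≤ 1 / gammaBar d ε}

/-- The entropy `E(r, b)`. -/
def entropy {d : ℕ} (Ω : Set (EuclideanSpace ℝ (Fin d))) (ε : ℝ)
    (Vr Vb r b : EuclideanSpace ℝ (Fin d) → ℝ) : ℝ :=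
  ∫ x in Ω, (r x * Real.log (r x) + b x * Real.log (b x) + r x * Vr x + b x * Vb x
    + alphaBar d ε / 2 * (r x ^ 2 + 2 * r x * b x + b x ^ 2))

/-- The map `(r, b) ↦ (u, v)` to the entropy variables
`u = log r + ᾱ (r + b) + V_r`, `v = log b + ᾱ (r + b) + V_b`,
for given values `vr`, `vb` of the potentials. -/
def entropyVars (a vr vb : ℝ) (p : ℝ × ℝ) : ℝ × ℝ :=
  (Real.log p.1 + a * (p.1 + p.2) + vr, Real.log p.2 + a * (p.1 + p.2) + vb)

/-- The gradient `E*'` of the dual entropy: the inverse `(u, v) ↦ (r, b)` of the map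
`(r, b) ↦ (u, v)` from positive densities to entropy variables. -/
def dualEntropyGrad (a vr vb : ℝ) : ℝ × ℝ → ℝ × ℝ :=
  Function.invFunOn (entropyVars a vr vb) {p | 0 < p.1 ∧ 0 < p.2}

/-- The Hessian `E*''` of the dual entropy, i.e. the Jacobian matrix
`(∂_u r, ∂_v r; ∂_u b, ∂_v b)` of `E*'`. -/
def dualEntropyHess (a vr vb : ℝ) (z : ℝ × ℝ) : Matrix (Fin 2) (Fin 2) ℝ :=
  !![(fderiv ℝ (dualEntropyGrad a vr vb) z (1, 0)).1,
     (fderiv ℝ (dualEntropyGrad a vr vb) z (0, 1)).1;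
     (fderiv ℝ (dualEntropyGrad a vr vb) z (1, 0)).2,
     (fderiv ℝ (dualEntropyGrad a vr vb) z (0, 1)).2]

/-- The mobility matrix `M(r, b)`. -/
def mobility (c r b : ℝ) : Matrix (Fin 2) (Fin 2) ℝ :=
  !![r * (1 - c * b), c * r * b;
     c * r * b, b * (1 - c * r)]

/-- The fields `(u, v)` of entropy variables of the densities `(r, b)`, as a pair of functions. -/
def entropyFields {d : ℕ} (ε : ℝ) (Vr Vb r b : EuclideanSpace ℝ (Fin d) → ℝ) :
    Fin 2 → EuclideanSpace ℝ (Fin d) → ℝ :=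
  ![fun x => (entropyVars (alphaBar d ε) (Vr x) (Vb x) (r x, b x)).1,
    fun x => (entropyVars (alphaBar d ε) (Vr x) (Vb x) (r x, b x)).2]

/-- `x ↦ E*''(u(x), v(x))`, where `(u, v)` are the entropy variables of `(r, b)`. -/
def dualHessField {d : ℕ} (ε : ℝ) (Vr Vb r b : EuclideanSpace ℝ (Fin d) → ℝ) :
    EuclideanSpace ℝ (Fin d) → Matrix (Fin 2) (Fin 2) ℝ :=
  fun x => dualEntropyHess (alphaBar d ε) (Vr x) (Vb x)
    (entropyVars (alphaBar d ε) (Vr x) (Vb x) (r x, b x))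

/-- `x ↦ M(r(x), b(x))`. -/
def mobilityField {d : ℕ} (ε : ℝ) (r b : EuclideanSpace ℝ (Fin d) → ℝ) :
    EuclideanSpace ℝ (Fin d) → Matrix (Fin 2) (Fin 2) ℝ :=
  fun x => mobility (gammaBar d ε) (r x) (b x)

/-! ### Weak formulations -/

/-- `∫_Ω A ζ · ψ dx` (bilinear, no complex conjugation). -/
def massForm {d : ℕ} {𝕜 : Type*} [RCLike 𝕜] (Ω : Set (EuclideanSpace ℝ (Fin d)))
    (A : EuclideanSpace ℝ (Fin d) → Matrix (Fin 2) (Fin 2) ℝ)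
    (ζ ψ : Fin 2 → EuclideanSpace ℝ (Fin d) → 𝕜) : 𝕜 :=
  ∫ x in Ω, ∑ i, ∑ j, A x i j • (ζ j x * ψ i x)

/-- `∫_Ω M G · H dx` for pairs of vector fields `G = (∇ζ₀, ∇ζ₁)`, `H = (∇ψ₀, ∇ψ₁)`
(bilinear, no complex conjugation). -/
def gradForm {d : ℕ} {𝕜 : Type*} [RCLike 𝕜] (Ω : Set (EuclideanSpace ℝ (Fin d)))
    (M : EuclideanSpace ℝ (Fin d) → Matrix (Fin 2) (Fin 2) ℝ)
    (G H : Fin 2 → Fin d → EuclideanSpace ℝ (Fin d) → 𝕜) : 𝕜 :=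
  ∫ x in Ω, ∑ i, ∑ j, M x i j • (∑ k, G j k x * H i k x)

/-- Measurable densities with values in `𝒮` almost everywhere. -/
structure IsDensityPair {d : ℕ} (Ω : Set (EuclideanSpace ℝ (Fin d))) (ε : ℝ)
    (r b : EuclideanSpace ℝ (Fin d) → ℝ) : Prop where
  meas_r : AEStronglyMeasurable r (volume.restrict Ω)
  meas_b : AEStronglyMeasurable b (volume.restrict Ω)
  mem : ∀ᵐ x ∂(volume.restrict Ω), (r x, b x) ∈ stateSet d ε

/-- The mass constraints `∫ r = N_r`, `∫ b = N_b`. -/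
def HasMasses {d : ℕ} (Ω : Set (EuclideanSpace ℝ (Fin d))) (Nr Nb : ℝ)
    (r b : EuclideanSpace ℝ (Fin d) → ℝ) : Prop :=
  ∫ x in Ω, r x = Nr ∧ ∫ x in Ω, b x = Nb

/-- `(r, b)` is a weak stationary solution, with values in the interior of `𝒮` and with masses
`N_r`, `N_b`, of `∂_t (r, b) = ∇ · [M(r, b) ∇(u, v)]` with no-flux boundary conditions. -/
structure IsStationarySolution {d : ℕ} (Ω : Set (EuclideanSpace ℝ (Fin d))) (ε : ℝ)
    (Vr Vb : EuclideanSpace ℝ (Fin d) → ℝ) (Nr Nb : ℝ)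
    (r b : EuclideanSpace ℝ (Fin d) → ℝ) : Prop where
  density : IsDensityPair Ω ε r b
  interior : ∀ᵐ x ∂(volume.restrict Ω), (r x, b x) ∈ interior (stateSet d ε)
  masses : HasMasses Ω Nr Nb r b
  weak : ∃ G : Fin 2 → Fin d → EuclideanSpace ℝ (Fin d) → ℝ,
    (∀ i, IsH1With Ω (entropyFields ε Vr Vb r b i) (G i)) ∧
    ∀ (ψ : Fin 2 → EuclideanSpace ℝ (Fin d) → ℝ)
      (H : Fin 2 → Fin d → EuclideanSpace ℝ (Fin d) → ℝ),
      (∀ i, IsH1With Ω (ψ i) (H i)) → gradForm Ω (mobilityField ε r b) G H = 0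

/-- The complex number `lam` is an eigenvalue, with eigenfunction `ζ = (ξ, η) ∈ H¹(Ω; ℂ)²`, of
`lam A ζ = ∇ · (M ∇ζ)` with no-flux boundary conditions, in the weak sense. -/
structure IsEigenpair {d : ℕ} (Ω : Set (EuclideanSpace ℝ (Fin d)))
    (A M : EuclideanSpace ℝ (Fin d) → Matrix (Fin 2) (Fin 2) ℝ)
    (lam : ℂ) (ζ : Fin 2 → EuclideanSpace ℝ (Fin d) → ℂ) : Prop where
  ne_zero : ¬ ∀ i, ζ i =ᵐ[volume.restrict Ω] 0
  weak : ∃ G : Fin 2 → Fin d → EuclideanSpace ℝ (Fin d) → ℂ,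
    (∀ i, IsH1With Ω (ζ i) (G i)) ∧
    ∀ (ψ : Fin 2 → EuclideanSpace ℝ (Fin d) → ℂ)
      (H : Fin 2 → Fin d → EuclideanSpace ℝ (Fin d) → ℂ),
      (∀ i, IsH1With Ω (ψ i) (H i)) → lam * massForm Ω A ζ ψ = - gradForm Ω M G H

/-- The perturbation `ζ` of the entropy variables preserves the masses to first order: the
corresponding perturbation `A ζ` of the densities has zero integral. -/
def IsMassPreserving {d : ℕ} (Ω : Set (EuclideanSpace ℝ (Fin d)))
    (A : EuclideanSpace ℝ (Fin d) → Matrix (Fin 2) (Fin 2) ℝ)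
    (ζ : Fin 2 → EuclideanSpace ℝ (Fin d) → ℂ) : Prop :=
  ∀ i, ∫ x in Ω, ∑ j, A x i j • ζ j x = 0

/-- `ζ = (ξ, η) ∈ L²(0,T;H¹(Ω))²` is a weak solution on `(0, T)` of `A ∂_t ζ = ∇ · (M ∇ζ)` with
no-flux boundary conditions and initial value `ζ₀ ∈ L²(Ω)²` (formulation integrated in time). -/
structure IsLinearisedSolution {d : ℕ} (Ω : Set (EuclideanSpace ℝ (Fin d)))
    (A M : EuclideanSpace ℝ (Fin d) → Matrix (Fin 2) (Fin 2) ℝ) (T : ℝ)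
    (ζ₀ : Fin 2 → EuclideanSpace ℝ (Fin d) → ℝ)
    (ζ : Fin 2 → ℝ → EuclideanSpace ℝ (Fin d) → ℝ) : Prop where
  initial : ∀ i, MemLp (ζ₀ i) 2 (volume.restrict Ω)
  weak : ∃ G : Fin 2 → Fin d → ℝ → EuclideanSpace ℝ (Fin d) → ℝ,
    (∀ i, IsL2H1With Ω T (ζ i) (G i)) ∧
    ∀ᵐ t ∂(volume.restrict (Ioo 0 T)),
      ∀ (ψ : Fin 2 → EuclideanSpace ℝ (Fin d) → ℝ)
        (H : Fin 2 → Fin d → EuclideanSpace ℝ (Fin d) → ℝ),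
        (∀ i, IsH1With Ω (ψ i) (H i)) →
          massForm Ω A (fun i => ζ i t) ψ + ∫ s in (0)..t, gradForm Ω M (fun i k => G i k s) H
            = massForm Ω A ζ₀ ψ

/-- Stability of the linear evolution `A ∂_t ζ = ∇ · (M ∇ζ)` (no-flux) under perturbations in
`L²(0,T;H¹(Ω))²`: small initial data give solutions that stay small, uniformly in time. -/
def IsLinearlyStable {d : ℕ} (Ω : Set (EuclideanSpace ℝ (Fin d)))
    (A M : EuclideanSpace ℝ (Fin d) → Matrix (Fin 2) (Fin 2) ℝ) : Prop :=
  ∃ C : ℝ, 0 < C ∧ ∀ (T : ℝ), 0 < T →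
    ∀ (ζ₀ : Fin 2 → EuclideanSpace ℝ (Fin d) → ℝ)
      (ζ : Fin 2 → ℝ → EuclideanSpace ℝ (Fin d) → ℝ),
      IsLinearisedSolution Ω A M T ζ₀ ζ →
        ∀ᵐ t ∂(volume.restrict (Ioo 0 T)),
          ∑ i, ∫ x in Ω, ζ i t x ^ 2 ≤ C * ∑ i, ∫ x in Ω, ζ₀ i x ^ 2

end HardSpheres

end

namespace HardSpheres

open Filter Topology Metric
open scoped Convolution ComplexConjugate

/-! Everything rests on two symmetric matrices being positive definite in the interior of the state
set: the mobility `M`, with determinant `r b (1 - γ̄ (r + b))`, and the dual Hessian, with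
determinant `r b / (1 + ᾱ (r + b))`. The second is the inverse of the Hessian of the entropy
density; its explicit form comes from the inverse function theorem (`dualEntropyHess_eq`).

Testing the stationary equation with the entropy variables themselves gives `∫ M ∇(u,v) · ∇(u,v) =
0`. Hence their gradients vanish, and on a connected domain they are constant
(`ae_const_of_weakGradient_zero`). Since `u + 1` and `v + 1` are the partial derivatives of the
entropy density, the constants act as Lagrange multipliers: the density lies above its tangent
plane, and the linear terms integrate to zero when the masses agree (`entropy_minimizer`).
Uniqueness of the stationary solution follows from the equality case.

For an eigenpair, testing with the complex conjugate gives `λ m = -g`, where `m > 0` is the weighted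
square norm and `g ≥ 0` the dissipation (`IsEigenpair.eigenvalue`).

Stability is an energy estimate for `F(t) = ∫ A ζ(t) · ζ(t)`. The weak formulation supplies no time
derivative, so the equations at times `s < t` are subtracted and tested with `ζ(t)`. This bounds
`F(t) - F(s)` by `-2 ∫_s^t k(σ,t) dσ`, where `k(σ,t) = ∫ M ∇ζ(σ) · ∇ζ(t)`. The integrand has no
sign, but integrating in `t` over `(s,τ)` turns the triangle into half a square, on which the
symmetric kernel `k` has nonnegative integral. So the mean of `F` over `(s,τ)` is at most `F(s)`,
and this averaged monotonicity already yields `F ≤ F₀` almost everywhere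
(`ae_le_of_energy_inequality`). Bounded potentials and constant entropy variables keep the densities
away from zero, so `F` is comparable to the `L²` norm. -/

/-! ### Functions with vanishing weak gradient -/

/-- The derivative falls on the mollifier, and `y ↦ φ (x - y)` is an admissible test function
because its support stays in `Ω`. -/
theorem fderiv_convolution_eq_zero {d : ℕ} {𝕜 : Type*} [RCLike 𝕜]
    {Ω : Set (EuclideanSpace ℝ (Fin d))} (hΩ : IsOpen Ω)
    {f : EuclideanSpace ℝ (Fin d) → 𝕜} (hf : Integrable f (volume.restrict Ω))
    (hg : HasWeakGradient Ω f 0) (φ : ContDiffBump (0 : EuclideanSpace ℝ (Fin d)))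
    {x : EuclideanSpace ℝ (Fin d)} (hx : closedBall x φ.rOut ⊆ Ω) :
    HasFDerivAt (φ.normed volume ⋆[ContinuousLinearMap.lsmul ℝ ℝ, volume] (Ω.indicator f))
      (0 : EuclideanSpace ℝ (Fin d) →L[ℝ] 𝕜) x := by
  have hfi : Integrable (Ω.indicator f) volume :=
    (integrable_indicator_iff hΩ.measurableSet).2 hf
  have hcs : HasCompactSupport (φ.normed volume) := φ.hasCompactSupport_normed
  have hcd : ContDiff ℝ ∞ (φ.normed volume) := φ.contDiff_normed
  have h1 := hcs.hasFDerivAt_convolution_right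
    (ContinuousLinearMap.lsmul ℝ ℝ : ℝ →L[ℝ] 𝕜 →L[ℝ] 𝕜).flip
    hfi.locallyIntegrable (hcd.of_le (by simp)) x
  rw [← convolution_flip (L := ContinuousLinearMap.lsmul ℝ ℝ)]
  refine h1.congr_fderiv (ContinuousLinearMap.coe_inj.1
    (Module.Basis.ext (EuclideanSpace.basisFun (Fin d) ℝ).toBasis fun i => ?_))
  simp only [OrthonormalBasis.coe_toBasis, EuclideanSpace.basisFun_apply,
    ContinuousLinearMap.coe_coe, ContinuousLinearMap.toLinearMap_zero, LinearMap.zero_apply]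
  rw [convolution_precompR_apply _ hfi.locallyIntegrable (hcs.fderiv ℝ)
    (hcd.continuous_fderiv (by simp))]
  have hts : tsupport (fun y => φ.normed volume (x - y)) ⊆ closedBall x φ.rOut := by
    refine closure_minimal (fun y hy => ?_) isClosed_closedBall
    have : x - y ∈ Function.support (φ.normed volume) := hy
    rw [φ.support_normed_eq] at this
    rw [mem_closedBall, dist_comm, dist_eq_norm]
    simpa using (mem_ball_zero_iff.1 this).le
  have h2 := hg i (fun y => φ.normed volume (x - y)) (hcd.comp (contDiff_const.sub contDiff_id))
    (HasCompactSupport.of_support_subset_isCompact (isCompact_closedBall x φ.rOut)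
      (subset_closure.trans hts)) (hts.trans hx)
  have h3 : ∀ y, fderiv ℝ (fun y => φ.normed volume (x - y)) y
      = - fderiv ℝ (φ.normed volume) (x - y) := fun y => by
    have h4 := ((hcd.differentiable (by simp)) (x - y)).hasFDerivAt.comp y
      ((hasFDerivAt_id y).const_sub x)
    refine h4.fderiv.trans ?_
    ext z
    simp
  simp only [h3, neg_apply, neg_smul, integral_neg, Pi.zero_apply, smul_zero,
    integral_zero, neg_zero, neg_eq_zero] at h2
  rw [convolution_def, ← h2, ← integral_indicator hΩ.measurableSet]
  refine integral_congr_ae (Eventually.of_forall fun y => ?_)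
  by_cases hy : y ∈ Ω <;> simp [hy]

/-- A function with vanishing weak gradient is constant near each point. -/
theorem locally_ae_const_of_weakGradient_zero {d : ℕ} {𝕜 : Type*} [RCLike 𝕜]
    {Ω : Set (EuclideanSpace ℝ (Fin d))} (hΩ : IsOpen Ω)
    {f : EuclideanSpace ℝ (Fin d) → 𝕜} (hf : Integrable f (volume.restrict Ω))
    (hg : HasWeakGradient Ω f 0) {x₀ : EuclideanSpace ℝ (Fin d)} (hx₀ : x₀ ∈ Ω) :
    ∃ R > 0, ball x₀ R ⊆ Ω ∧ ∃ c : 𝕜, ∀ᵐ x, x ∈ ball x₀ R → f x = c := by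
  obtain ⟨R, hR, hRΩ⟩ := Metric.isOpen_iff.1 hΩ x₀ hx₀
  have hfi : Integrable (Ω.indicator f) volume :=
    (integrable_indicator_iff hΩ.measurableSet).2 hf
  -- The outer radius is always twice the inner one: a.e. convergence of the mollifications needs a
  -- bounded ratio, here `K := 2`.
  let φ : ℕ → ContDiffBump (0 : EuclideanSpace ℝ (Fin d)) := fun n =>
    ⟨1 / ((n : ℝ) + 1), 2 * (1 / ((n : ℝ) + 1)), by positivity,
      by have : 0 < 1 / ((n : ℝ) + 1) := by positivity
         linarith⟩
  have hφ : Tendsto (fun n => (φ n).rOut) atTop (𝓝 0) := by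
    change Tendsto (fun n : ℕ => 2 * (1 / ((n : ℝ) + 1))) atTop (𝓝 0)
    simpa using (tendsto_one_div_add_atTop_nhds_zero_nat (𝕜 := ℝ)).const_mul 2
  have hae := ContDiffBump.ae_convolution_tendsto_right_of_locallyIntegrable (μ := volume)
    (K := 2) hφ (Eventually.of_forall fun n => le_rfl) hfi.locallyIntegrable
  have hsub : ball x₀ (R / 2) ⊆ Ω := (ball_subset_ball (by linarith)).trans hRΩ
  refine ⟨R / 2, by positivity, hsub, ?_⟩
  -- Once the mollification radius is below `R / 2`, its support around any point of the half ball
  -- stays inside `ball x₀ R`.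
  have hconst : ∀ᶠ n in atTop, ∀ x ∈ ball x₀ (R / 2), ∀ y ∈ ball x₀ (R / 2),
      ((φ n).normed volume ⋆[ContinuousLinearMap.lsmul ℝ ℝ, volume] (Ω.indicator f)) x
      = ((φ n).normed volume ⋆[ContinuousLinearMap.lsmul ℝ ℝ, volume] (Ω.indicator f)) y := by
    filter_upwards [hφ.eventually (gt_mem_nhds (show (0 : ℝ) < R / 2 by positivity))]
      with n hn x hx y hy
    have hd : ∀ z ∈ ball x₀ (R / 2), HasFDerivAt
        ((φ n).normed volume ⋆[ContinuousLinearMap.lsmul ℝ ℝ, volume] (Ω.indicator f))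
        (0 : EuclideanSpace ℝ (Fin d) →L[ℝ] 𝕜) z := fun z hz => by
      refine fderiv_convolution_eq_zero hΩ hf hg _ (fun w hw => hRΩ ?_)
      have h1 := mem_closedBall.1 hw
      have h2 := mem_ball.1 hz
      have := dist_triangle w z x₀
      exact mem_ball.2 (by linarith)
    exact (convex_ball x₀ (R / 2)).is_const_of_fderivWithin_eq_zero (𝕜 := ℝ)
      (fun z hz => (hd z hz).differentiableAt.differentiableWithinAt)
      (fun z hz => ((hd z hz).hasFDerivWithinAt).fderivWithin
        (isOpen_ball.uniqueDiffWithinAt hz)) hx hy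
  have hball : volume (ball x₀ (R / 2)) ≠ 0 := (measure_ball_pos _ _ (by positivity)).ne'
  obtain ⟨y, hy, hyt⟩ : ∃ y ∈ ball x₀ (R / 2), Tendsto (fun n =>
      ((φ n).normed volume ⋆[ContinuousLinearMap.lsmul ℝ ℝ, volume] (Ω.indicator f)) y) atTop
      (𝓝 (Ω.indicator f y)) := by
    by_contra! h
    exact hball (measure_mono_null (fun y hy => h y hy) (ae_iff.1 hae))
  refine ⟨f y, ?_⟩
  filter_upwards [hae] with x hx hxb
  have h1 := hx.congr' (hconst.mono fun n hn => hn x hxb y hy)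
  have := tendsto_nhds_unique h1 hyt
  rwa [indicator_of_mem (hsub hxb), indicator_of_mem (hsub hy)] at this

/-- A function with vanishing weak gradient on a connected open set is constant. -/
theorem ae_const_of_weakGradient_zero {d : ℕ} {𝕜 : Type*} [RCLike 𝕜]
    {Ω : Set (EuclideanSpace ℝ (Fin d))} (hΩ : IsOpen Ω) (hc : IsConnected Ω)
    {f : EuclideanSpace ℝ (Fin d) → 𝕜} (hf : Integrable f (volume.restrict Ω))
    (hg : HasWeakGradient Ω f 0) : ∃ c : 𝕜, ∀ᵐ x ∂(volume.restrict Ω), f x = c := by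
  have hloc := fun (x : EuclideanSpace ℝ (Fin d)) (hx : x ∈ Ω) =>
    locally_ae_const_of_weakGradient_zero hΩ hf hg hx
  choose! R hR hRΩ c hcc using hloc
  -- Nonempty open sets have positive measure, so the local a.e. constants agree on overlapping
  -- balls.
  have hmeet : ∀ {a b : 𝕜} {U : Set (EuclideanSpace ℝ (Fin d))}, IsOpen U → U.Nonempty →
      (∀ᵐ x, x ∈ U → f x = a) → (∀ᵐ x, x ∈ U → f x = b) → a = b := by
    intro a b U hU hne ha hb
    by_contra hab
    refine (hU.measure_pos volume hne).ne' (measure_mono_null (fun x hx => ?_)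
      (ae_iff.1 (ha.and hb)))
    exact fun h => hab ((h.1 hx).symm.trans (h.2 hx))
  have hlc : ∀ x ∈ Ω, ∀ y ∈ ball x (R x), c y = c x := by
    intro x hx y hy
    have hyΩ := hRΩ x hx hy
    refine hmeet (isOpen_ball.inter isOpen_ball) ⟨y, mem_ball_self (hR y hyΩ), hy⟩
      (U := ball y (R y) ∩ ball x (R x)) ?_ ?_
    · filter_upwards [hcc y hyΩ] with z hz hzU using hz hzU.1
    · filter_upwards [hcc x hx] with z hz hzU using hz hzU.2
  obtain ⟨x₀, hx₀⟩ := hc.nonempty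
  have hconst : ∀ x ∈ Ω, c x = c x₀ := by
    have : PreconnectedSpace Ω := isPreconnected_iff_preconnectedSpace.1 hc.isPreconnected
    have hl : IsLocallyConstant (fun x : Ω => c x) := by
      refine (IsLocallyConstant.iff_eventually_eq _).2 fun x => ?_
      have h : ∀ᶠ y in 𝓝 (x : EuclideanSpace ℝ (Fin d)), c y = c x :=
        eventually_of_mem (ball_mem_nhds _ (hR x x.2)) fun y hy => hlc x x.2 y hy
      exact continuous_subtype_val.continuousAt.eventually h
    exact fun x hx => hl.apply_eq_of_preconnectedSpace ⟨x, hx⟩ ⟨x₀, hx₀⟩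
  refine ⟨c x₀, ?_⟩
  rw [ae_restrict_iff' hΩ.measurableSet, ae_iff]
  refine measure_null_of_locally_null _ fun x hx => ?_
  have hxΩ : x ∈ Ω := by
    by_contra h
    exact hx fun h' => absurd h' h
  refine ⟨{y | ¬ (y ∈ Ω → f y = c x₀)} ∩ ball x (R x), inter_mem self_mem_nhdsWithin
    (mem_nhdsWithin_of_mem_nhds (ball_mem_nhds x (hR x hxΩ))), ?_⟩
  refine measure_mono_null ?_ (ae_iff.1 (hcc x hxΩ))
  exact fun y hy (h : y ∈ ball x (R x) → f y = c x) =>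
    hy.1 fun _ => (h hy.2).trans (hconst x hxΩ)

/-- The weak gradient of an a.e. constant function vanishes. -/
theorem hasWeakGradient_zero_of_ae_const {d : ℕ} {𝕜 : Type*} [RCLike 𝕜]
    {Ω : Set (EuclideanSpace ℝ (Fin d))}
    {f : EuclideanSpace ℝ (Fin d) → 𝕜} {c : 𝕜} (hf : ∀ᵐ x ∂(volume.restrict Ω), f x = c) :
    HasWeakGradient Ω f 0 := by
  intro i φ hφ hφc hφΩ
  have h1 : ∫ x in Ω, fderiv ℝ φ x (EuclideanSpace.single i 1) • f x
      = ∫ x in Ω, fderiv ℝ φ x (EuclideanSpace.single i 1) • c :=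
    integral_congr_ae (hf.mono fun x hx => by simp only [hx])
  have h2 : Integrable (fun x => fderiv ℝ φ x (EuclideanSpace.single i 1)) :=
    ((hφ.continuous_fderiv (by simp)).clm_apply continuous_const).integrable_of_hasCompactSupport
      (hφc.fderiv_apply ℝ _)
  -- Integration by parts against the constant `1`: a partial derivative of a test function has zero
  -- integral.
  have h3 := integral_mul_fderiv_eq_neg_fderiv_mul_of_integrable (μ := volume) (𝕜 := ℝ)
    (f := fun _ : EuclideanSpace ℝ (Fin d) => (1 : ℝ)) (g := φ) (v := EuclideanSpace.single i 1)
    (by simp) (by simpa using h2)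
    (by simpa using hφ.continuous.integrable_of_hasCompactSupport hφc)
    (fun x _ => differentiableAt_const _)
    (fun x _ => (hφ.differentiable (by simp)).differentiableAt)
  simp only [one_mul, fderiv_fun_const, Pi.zero_apply, zero_apply, zero_mul,
    integral_zero, neg_zero] at h3
  rw [h1, integral_smul_const, setIntegral_eq_integral_of_forall_compl_eq_zero, h3]
  · simp
  · intro x hx
    have : x ∉ tsupport (fderiv ℝ φ) := fun h => hx (hφΩ (tsupport_fderiv_subset ℝ h))
    simp [image_eq_zero_of_notMem_tsupport this]

/-! ### Pointwise algebra of the mobility and of the dual Hessian -/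

theorem alphaBar_pos {d : ℕ} (hd : 2 ≤ d) {ε : ℝ} (hε : 0 < ε) : 0 < alphaBar d ε := by
  have h : (2 : ℝ) ≤ d := by exact_mod_cast hd
  have h1 : (0 : ℝ) < (d : ℝ) - 1 := by linarith
  unfold alphaBar
  positivity

theorem gammaBar_pos {d : ℕ} (hd : 2 ≤ d) {ε : ℝ} (hε : 0 < ε) : 0 < gammaBar d ε := by
  have h : (2 : ℝ) ≤ d := by exact_mod_cast hd
  unfold gammaBar
  positivity

theorem of_mem_interior_stateSet {d : ℕ} {ε : ℝ} {p : ℝ × ℝ} (hp : p ∈ interior (stateSet d ε)) :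
    0 < p.1 ∧ 0 < p.2 ∧ p.1 + p.2 < 1 / gammaBar d ε := by
  obtain ⟨δ, hδ, h⟩ := Metric.mem_nhds_iff.1 (mem_interior_iff_mem_nhds.1 hp)
  have h1 : ((p.1 - δ / 2, p.2) : ℝ × ℝ) ∈ stateSet d ε := h (by
    simp [Prod.dist_eq, abs_of_pos, hδ])
  have h2 : ((p.1, p.2 - δ / 2) : ℝ × ℝ) ∈ stateSet d ε := h (by
    simp [Prod.dist_eq, abs_of_pos, hδ])
  have h3 : ((p.1 + δ / 2, p.2) : ℝ × ℝ) ∈ stateSet d ε := h (by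
    simp [Prod.dist_eq, abs_of_pos, hδ])
  simp only [stateSet, mem_ofPred_eq] at h1 h2 h3
  exact ⟨by linarith, by linarith, by linarith⟩

theorem posDef_of_fin_two {p q s : ℝ} (hp : 0 < p) (hdet : q * q < p * s) :
    (!![p, q; q, s] : Matrix (Fin 2) (Fin 2) ℝ).PosDef := by
  refine Matrix.PosDef.of_dotProduct_mulVec_pos ?_ fun y hy => ?_
  · ext i j
    fin_cases i <;> fin_cases j <;> simp
  · have h : star y ⬝ᵥ ((!![p, q; q, s] : Matrix (Fin 2) (Fin 2) ℝ).mulVec y)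
        = p * y 0 ^ 2 + 2 * q * y 0 * y 1 + s * y 1 ^ 2 := by
      simp [dotProduct, Matrix.mulVec, Fin.sum_univ_two]
      ring
    rw [h]
    by_cases h1 : y 1 = 0
    · have h0 : y 0 ≠ 0 := fun h0 => hy (by ext i; fin_cases i <;> simp [h0, h1])
      have := mul_pos hp (sq_pos_of_ne_zero h0)
      simpa [h1] using this
    · have h2 : 0 < (p * s - q * q) * y 1 ^ 2 :=
        mul_pos (by linarith) (sq_pos_of_ne_zero h1)
      -- Completing the square: `p` times the form is `(p y₀ + q y₁)² + (p s - q²) y₁²`.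
      refine pos_of_mul_pos_right (b := _) (a := p) ?_ hp.le
      nlinarith [sq_nonneg (p * y 0 + q * y 1)]

/-- The determinant is `r b (1 - c (r + b))`, so the strict volume constraint is what makes it
positive. -/
theorem mobility_posDef {c r b : ℝ} (hc : 0 < c) (hr : 0 < r) (hb : 0 < b) (hrb : r + b < 1 / c) :
    (mobility c r b).PosDef := by
  have h : c * (r + b) < 1 := by
    rw [lt_div_iff₀ hc] at hrb
    linarith
  have h1 : c * b < 1 := by nlinarith
  refine posDef_of_fin_two (mul_pos hr (by linarith)) ?_
  have h2 : 0 < r * b * (1 - c * (r + b)) := mul_pos (mul_pos hr hb) (by linarith)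
  nlinarith

/-- The inverse of the Hessian of the entropy density. -/
noncomputable def invHess (a r b : ℝ) : Matrix (Fin 2) (Fin 2) ℝ :=
  !![r * (1 + a * b) / (1 + a * (r + b)), -(a * r * b / (1 + a * (r + b)));
     -(a * r * b / (1 + a * (r + b))), b * (1 + a * r) / (1 + a * (r + b))]

/-- If the totals `r + b` differed, then with `a > 0` both logarithms would have to be smaller where
the total is larger, which is absurd. With equal totals the logarithms agree. -/
theorem entropyVars_injOn {a : ℝ} (ha : 0 < a) (vr vb : ℝ) :
    InjOn (entropyVars a vr vb) {p | 0 < p.1 ∧ 0 < p.2} := by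
  rintro ⟨r, b⟩ ⟨hr, hb⟩ ⟨r', b'⟩ ⟨hr', hb'⟩ h
  simp only [entropyVars, Prod.mk.injEq] at h hr hb hr' hb'
  obtain ⟨h1, h2⟩ := h
  have key : r + b = r' + b' := by
    rcases lt_trichotomy (r + b) (r' + b') with h | h | h
    · have h3 := mul_lt_mul_of_pos_left h ha
      have h4 := (Real.log_lt_log_iff hr' hr).1 (by linarith)
      have h5 := (Real.log_lt_log_iff hb' hb).1 (by linarith)
      linarith
    · exact h
    · have h3 := mul_lt_mul_of_pos_left h ha
      have h4 := (Real.log_lt_log_iff hr hr').1 (by linarith)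
      have h5 := (Real.log_lt_log_iff hb hb').1 (by linarith)
      linarith
  rw [key] at h1 h2
  exact Prod.ext (Real.log_injOn_pos hr hr' (by linarith)) (Real.log_injOn_pos hb hb' (by linarith))

/-- The Hessian of the entropy density, as a linear isomorphism. -/
noncomputable def hessEquiv {a r b : ℝ} (ha : 0 < a) (hr : 0 < r) (hb : 0 < b) : (ℝ × ℝ) ≃L[ℝ] (ℝ × ℝ) :=
  ContinuousLinearEquiv.equivOfInverse
    ((((r⁻¹ + a) • ContinuousLinearMap.fst ℝ ℝ ℝ + a • ContinuousLinearMap.snd ℝ ℝ ℝ)).prod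
      (a • ContinuousLinearMap.fst ℝ ℝ ℝ + (b⁻¹ + a) • ContinuousLinearMap.snd ℝ ℝ ℝ))
    ((invHess a r b 0 0 • ContinuousLinearMap.fst ℝ ℝ ℝ
      + invHess a r b 0 1 • ContinuousLinearMap.snd ℝ ℝ ℝ).prod
      (invHess a r b 1 0 • ContinuousLinearMap.fst ℝ ℝ ℝ
      + invHess a r b 1 1 • ContinuousLinearMap.snd ℝ ℝ ℝ))
    (fun ⟨x, y⟩ => by
      have : 0 < 1 + a * (r + b) := by positivity
      ext
      · simp [invHess]; field_simp; ring
      · simp [invHess]; field_simp; ring)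
    (fun ⟨x, y⟩ => by
      have : 0 < 1 + a * (r + b) := by positivity
      ext
      · simp [invHess]; field_simp; ring
      · simp [invHess]; field_simp; ring)

theorem hessEquiv_symm_apply {a r b : ℝ} (ha : 0 < a) (hr : 0 < r) (hb : 0 < b) (z : ℝ × ℝ) :
    (hessEquiv ha hr hb).symm z = (invHess a r b 0 0 * z.1 + invHess a r b 0 1 * z.2,
      invHess a r b 1 0 * z.1 + invHess a r b 1 1 * z.2) := rfl

theorem entropyVars_hasStrictFDerivAt {a r b : ℝ} (ha : 0 < a) (hr : 0 < r) (hb : 0 < b)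
    (vr vb : ℝ) :
    HasStrictFDerivAt (entropyVars a vr vb)
      (hessEquiv ha hr hb : (ℝ × ℝ) →L[ℝ] (ℝ × ℝ)) (r, b) := by
  have h1 : HasStrictFDerivAt (Prod.fst : ℝ × ℝ → ℝ) (ContinuousLinearMap.fst ℝ ℝ ℝ) (r, b) :=
    hasStrictFDerivAt_fst
  have h2 : HasStrictFDerivAt (Prod.snd : ℝ × ℝ → ℝ) (ContinuousLinearMap.snd ℝ ℝ ℝ) (r, b) :=
    hasStrictFDerivAt_snd
  have h3 := ((h1.log hr.ne').add ((h1.add h2).const_mul a)).add_const vr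
  have h4 := ((h2.log hb.ne').add ((h1.add h2).const_mul a)).add_const vb
  refine (h3.prodMk h4).congr_fderiv ?_
  ext <;> simp [hessEquiv, ContinuousLinearEquiv.equivOfInverse]

/-- The globally chosen inverse coincides near the image point with the local inverse of the inverse
function theorem: by continuity the latter stays in the positive quadrant, where the map is
injective. -/
theorem dualEntropyGrad_hasFDerivAt {a r b : ℝ} (ha : 0 < a) (hr : 0 < r) (hb : 0 < b)
    (vr vb : ℝ) :
    HasFDerivAt (dualEntropyGrad a vr vb)
      ((hessEquiv ha hr hb).symm : (ℝ × ℝ) →L[ℝ] (ℝ × ℝ)) (entropyVars a vr vb (r, b)) := by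
  have hf := entropyVars_hasStrictFDerivAt ha hr hb vr vb
  refine hf.to_localInverse.hasFDerivAt.congr_of_eventuallyEq ?_
  have hpos : {p : ℝ × ℝ | 0 < p.1 ∧ 0 < p.2} ∈ 𝓝 (r, b) :=
    ((isOpen_lt continuous_const continuous_fst).inter
      (isOpen_lt continuous_const continuous_snd)).mem_nhds ⟨hr, hb⟩
  have hcont := hf.localInverse_continuousAt
  rw [ContinuousAt, hf.localInverse_apply_image] at hcont
  filter_upwards [hf.eventually_right_inverse, hcont hpos] with y hy hy'
  have hex : ∃ p ∈ {p : ℝ × ℝ | 0 < p.1 ∧ 0 < p.2}, entropyVars a vr vb p = y := ⟨_, hy', hy⟩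
  exact entropyVars_injOn ha vr vb (Function.invFunOn_mem hex) hy'
    ((Function.invFunOn_eq hex).trans hy.symm)

theorem dualEntropyHess_eq {a r b : ℝ} (ha : 0 < a) (hr : 0 < r) (hb : 0 < b) (vr vb : ℝ) :
    dualEntropyHess a vr vb (entropyVars a vr vb (r, b)) = invHess a r b := by
  rw [dualEntropyHess, (dualEntropyGrad_hasFDerivAt ha hr hb vr vb).fderiv]
  ext i j
  fin_cases i <;> fin_cases j <;> simp [hessEquiv_symm_apply]

theorem invHess_posDef {a r b : ℝ} (ha : 0 < a) (hr : 0 < r) (hb : 0 < b) :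
    (invHess a r b).PosDef := by
  have hD : 0 < 1 + a * (r + b) := by positivity
  refine posDef_of_fin_two (by positivity) ?_
  have h : r * (1 + a * b) / (1 + a * (r + b)) * (b * (1 + a * r) / (1 + a * (r + b)))
      - -(a * r * b / (1 + a * (r + b))) * -(a * r * b / (1 + a * (r + b)))
      = r * b / (1 + a * (r + b)) := by
    field_simp
    ring
  have : 0 < r * b / (1 + a * (r + b)) := by positivity
  linarith

theorem abs_invHess_le {a r b K : ℝ} (ha : 0 < a) (hr : 0 < r) (hb : 0 < b) (hrK : r ≤ K)
    (hbK : b ≤ K) (i j : Fin 2) : |invHess a r b i j| ≤ K := by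
  have hD : 0 < 1 + a * (r + b) := by positivity
  have har := mul_pos ha hr
  have hab := mul_pos ha hb
  have h1 : r * (1 + a * b) / (1 + a * (r + b)) ≤ r := by
    rw [div_le_iff₀ hD]
    exact mul_le_mul_of_nonneg_left (by linarith) hr.le
  have h2 : b * (1 + a * r) / (1 + a * (r + b)) ≤ b := by
    rw [div_le_iff₀ hD]
    exact mul_le_mul_of_nonneg_left (by linarith) hb.le
  have h3 : a * r * b / (1 + a * (r + b)) ≤ r := by
    rw [div_le_iff₀ hD, mul_comm a r, mul_assoc]
    exact mul_le_mul_of_nonneg_left (by linarith) hr.le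
  have p1 : 0 ≤ r * (1 + a * b) / (1 + a * (r + b)) := by positivity
  have p2 : 0 ≤ b * (1 + a * r) / (1 + a * (r + b)) := by positivity
  have p3 : 0 ≤ a * r * b / (1 + a * (r + b)) := by positivity
  fin_cases i <;> fin_cases j <;> simp only [invHess, Fin.zero_eta, Fin.mk_one, Matrix.of_apply,
    Matrix.cons_val_zero, Matrix.cons_val_one, Matrix.cons_val', Matrix.cons_val_fin_one, abs_neg]
    <;> rw [abs_of_nonneg ‹_›] <;> linarith

theorem abs_mobility_le {c r b K : ℝ} (hc : 0 < c) (hr : 0 < r) (hb : 0 < b)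
    (hrb : r + b < 1 / c) (hrK : r ≤ K) (hbK : b ≤ K) (i j : Fin 2) : |mobility c r b i j| ≤ K := by
  have h : c * (r + b) < 1 := by
    rw [lt_div_iff₀ hc] at hrb
    linarith
  have hcr := mul_pos hc hr
  have hcb := mul_pos hc hb
  have h1 : r * (1 - c * b) ≤ r * 1 := mul_le_mul_of_nonneg_left (by linarith) hr.le
  have h2 : b * (1 - c * r) ≤ b * 1 := mul_le_mul_of_nonneg_left (by linarith) hb.le
  have h3 : b * (c * r) ≤ b * 1 := mul_le_mul_of_nonneg_left (by linarith) hb.le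
  have p1 : 0 ≤ r * (1 - c * b) := mul_nonneg hr.le (by linarith)
  have p2 : 0 ≤ b * (1 - c * r) := mul_nonneg hb.le (by linarith)
  have p3 : 0 ≤ c * r * b := by positivity
  fin_cases i <;> fin_cases j <;> simp only [mobility, Fin.zero_eta, Fin.mk_one, Matrix.of_apply,
    Matrix.cons_val_zero, Matrix.cons_val_one, Matrix.cons_val', Matrix.cons_val_fin_one]
    <;> rw [abs_of_nonneg ‹_›] <;> linarith

/-- The form equals `(r y₀² + b y₁² + a r b (y₀ - y₁)²) / (1 + a (r + b))`; the last square is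
dropped. The bound is uniform in `x` and gives the constant in the stability estimate. -/
theorem invHess_coercive {a r b m K : ℝ} (ha : 0 < a) (hr : 0 < r) (hb : 0 < b) (hm : 0 ≤ m)
    (hmr : m ≤ r) (hmb : m ≤ b) (hrK : r ≤ K) (hbK : b ≤ K) (y : Fin 2 → ℝ) :
    m / (1 + a * (K + K)) * ∑ i, y i ^ 2 ≤ ∑ i, ∑ j, invHess a r b i j * (y j * y i) := by
  have hD : 0 < 1 + a * (r + b) := by positivity
  have hDK : 1 + a * (r + b) ≤ 1 + a * (K + K) := by gcongr
  have h : ∑ i, ∑ j, invHess a r b i j * (y j * y i)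
      = (r * y 0 ^ 2 + b * y 1 ^ 2 + a * r * b * (y 0 - y 1) ^ 2) / (1 + a * (r + b)) := by
    simp [invHess, Fin.sum_univ_two]
    field_simp
    ring
  rw [h, Fin.sum_univ_two]
  calc m / (1 + a * (K + K)) * (y 0 ^ 2 + y 1 ^ 2)
      ≤ m / (1 + a * (r + b)) * (y 0 ^ 2 + y 1 ^ 2) := by gcongr
    _ = (m * y 0 ^ 2 + m * y 1 ^ 2 + 0) / (1 + a * (r + b)) := by ring
    _ ≤ _ := by gcongr; positivity

/-! ### Convexity of the entropy -/

/-- The integrand of the entropy. -/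
noncomputable def entropyDensity (a vr vb r b : ℝ) : ℝ :=
  r * Real.log r + b * Real.log b + r * vr + b * vb + a / 2 * (r ^ 2 + 2 * r * b + b ^ 2)

/-- Strictness comes from `x log x` in each variable; the interaction is the convex square `a / 2 (r
+ b)²`, degenerate along `r + b` constant. The equality case is kept separate so that it can be used
almost everywhere under the integral. -/
theorem entropyDensity_convex {a : ℝ} (ha : 0 < a) (vr vb : ℝ) {r₁ b₁ r₂ b₂ s : ℝ} (hr₁ : 0 ≤ r₁)
    (hb₁ : 0 ≤ b₁) (hr₂ : 0 ≤ r₂) (hb₂ : 0 ≤ b₂) (hs : s ∈ Ioo (0 : ℝ) 1) :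
    entropyDensity a vr vb ((1 - s) * r₁ + s * r₂) ((1 - s) * b₁ + s * b₂)
        ≤ (1 - s) * entropyDensity a vr vb r₁ b₁ + s * entropyDensity a vr vb r₂ b₂ ∧
      (entropyDensity a vr vb ((1 - s) * r₁ + s * r₂) ((1 - s) * b₁ + s * b₂)
        = (1 - s) * entropyDensity a vr vb r₁ b₁ + s * entropyDensity a vr vb r₂ b₂ →
        r₁ = r₂ ∧ b₁ = b₂) := by
  have h1s : 0 < 1 - s := by linarith [hs.2]
  have hlt : ∀ {x y : ℝ}, 0 ≤ x → 0 ≤ y → x ≠ y →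
      ((1 - s) * x + s * y) * Real.log ((1 - s) * x + s * y)
        < (1 - s) * (x * Real.log x) + s * (y * Real.log y) := fun hx hy hxy => by
    simpa using Real.strictConvexOn_mul_log.2 hx hy hxy h1s hs.1 (by ring)
  have hle : ∀ {x y : ℝ}, 0 ≤ x → 0 ≤ y →
      ((1 - s) * x + s * y) * Real.log ((1 - s) * x + s * y)
        ≤ (1 - s) * (x * Real.log x) + s * (y * Real.log y) := fun {x y} hx hy => by
    rcases eq_or_ne x y with rfl | hxy
    · have : (1 - s) * x + s * x = x := by ring
      rw [this]
      linarith
    · exact (hlt hx hy hxy).le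
  have hq : 0 ≤ a / 2 * ((1 - s) * s * ((r₁ + b₁) - (r₂ + b₂)) ^ 2) :=
    mul_nonneg (by positivity) (mul_nonneg (mul_nonneg h1s.le hs.1.le) (sq_nonneg _))
  have hr := hle hr₁ hr₂
  have hb := hle hb₁ hb₂
  unfold entropyDensity
  refine ⟨by nlinarith, fun h => ⟨?_, ?_⟩⟩
  · by_contra hne
    have := hlt hr₁ hr₂ hne
    nlinarith
  · by_contra hne
    have := hlt hb₁ hb₂ hne
    nlinarith

/-- For `x > 0` this is `log z < z - 1` at `z = y / x`, multiplied by `x`; at `x = 0` it reads `-y <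
0`. -/
theorem mul_log_tangent_lt {x y : ℝ} (hy : 0 < y) (hx : 0 ≤ x) (hxy : x ≠ y) :
    y * Real.log y + (Real.log y + 1) * (x - y) < x * Real.log x := by
  rcases hx.eq_or_lt with rfl | hx
  · simp
    linarith
  · have h := Real.log_lt_sub_one_of_pos (div_pos hy hx) (fun h => hxy ((div_eq_one_iff_eq
      hx.ne').1 h).symm)
    rw [Real.log_div hy.ne' hx.ne'] at h
    have h2 := mul_lt_mul_of_pos_left h hx
    have h3 : x * (y / x - 1) = y - x := by field_simp
    nlinarith

/-- The partial derivatives of the density are `u + 1` and `v + 1`. The remainder is the sum of two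
`x log x` remainders and `a / 2 ((r' + b') - (r + b))²`. The competitor may touch the boundary of
the quadrant. -/
theorem entropyDensity_tangent {a : ℝ} (ha : 0 < a) (vr vb : ℝ) {r b r' b' : ℝ} (hr : 0 < r)
    (hb : 0 < b) (hr' : 0 ≤ r') (hb' : 0 ≤ b') :
    0 ≤ entropyDensity a vr vb r' b' - entropyDensity a vr vb r b
        - ((entropyVars a vr vb (r, b)).1 + 1) * (r' - r)
        - ((entropyVars a vr vb (r, b)).2 + 1) * (b' - b) ∧
      (entropyDensity a vr vb r' b' - entropyDensity a vr vb r b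
        - ((entropyVars a vr vb (r, b)).1 + 1) * (r' - r)
        - ((entropyVars a vr vb (r, b)).2 + 1) * (b' - b) = 0 → r' = r ∧ b' = b) := by
  have hle : ∀ {x y : ℝ}, 0 < y → 0 ≤ x →
      y * Real.log y + (Real.log y + 1) * (x - y) ≤ x * Real.log x := fun {x y} hy hx => by
    rcases eq_or_ne x y with rfl | hxy
    · simp
    · exact (mul_log_tangent_lt hy hx hxy).le
  have hq : 0 ≤ a / 2 * ((r' + b') - (r + b)) ^ 2 := by positivity
  have h1 := hle hr hr'
  have h2 := hle hb hb'
  unfold entropyDensity entropyVars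
  refine ⟨by nlinarith, fun h => ⟨?_, ?_⟩⟩
  · by_contra hne
    have := mul_log_tangent_lt hr hr' hne
    nlinarith
  · by_contra hne
    have := mul_log_tangent_lt hb hb' hne
    nlinarith

section Integrability

variable {X : Type*} [MeasurableSpace X] {μ : Measure X}

theorem integrable_comp_of_mem_Icc [IsFiniteMeasure μ] {f : X → ℝ} {g : ℝ → ℝ} {K : ℝ} (hg : Continuous g)
    (hf : AEStronglyMeasurable f μ) (hfK : ∀ᵐ x ∂μ, f x ∈ Icc 0 K) :
    Integrable (fun x => g (f x)) μ := by
  obtain ⟨C, hC⟩ := (isCompact_Icc (a := (0 : ℝ)) (b := K)).exists_bound_of_continuousOn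
    hg.continuousOn
  exact Integrable.of_bound (hg.comp_aestronglyMeasurable hf) C (hfK.mono fun x hx => hC _ hx)

theorem integrable_mul_of_mem_Icc {f V : X → ℝ} {K : ℝ}
    (hf : AEStronglyMeasurable f μ) (hfK : ∀ᵐ x ∂μ, f x ∈ Icc 0 K) (hV : Integrable V μ) :
    Integrable (fun x => f x * V x) μ :=
  hV.bdd_mul hf (hfK.mono fun x hx => by
    rw [Real.norm_eq_abs, abs_of_nonneg hx.1]
    exact hx.2)

theorem integrable_entropyDensity [IsFiniteMeasure μ] {a K : ℝ} {Vr Vb r b : X → ℝ} (hVr : Integrable Vr μ)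
    (hVb : Integrable Vb μ) (hr : AEStronglyMeasurable r μ) (hb : AEStronglyMeasurable b μ)
    (hrK : ∀ᵐ x ∂μ, r x ∈ Icc 0 K) (hbK : ∀ᵐ x ∂μ, b x ∈ Icc 0 K) :
    Integrable (fun x => entropyDensity a (Vr x) (Vb x) (r x) (b x)) μ := by
  have hbi : Integrable b μ := integrable_comp_of_mem_Icc continuous_id hb hbK
  have h1 := integrable_comp_of_mem_Icc Real.continuous_mul_log hr hrK
  have h2 := integrable_comp_of_mem_Icc Real.continuous_mul_log hb hbK
  have h3 := integrable_mul_of_mem_Icc hr hrK hVr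
  have h4 := integrable_mul_of_mem_Icc hb hbK hVb
  have h5 := integrable_comp_of_mem_Icc (continuous_pow 2) hr hrK
  have h6 := integrable_comp_of_mem_Icc (continuous_pow 2) hb hbK
  have h7 : Integrable (fun x => 2 * r x * b x) μ := by
    simpa only [mul_assoc] using (integrable_mul_of_mem_Icc hr hrK hbi).const_mul 2
  exact (((h1.add h2).add h3).add h4).add (((h5.add h7).add h6).const_mul (a / 2))

end Integrability

section Entropy

variable {d : ℕ} {Ω : Set (EuclideanSpace ℝ (Fin d))} {ε : ℝ}

theorem IsDensityPair.mem_Icc {r b : EuclideanSpace ℝ (Fin d) → ℝ} (h : IsDensityPair Ω ε r b) :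
    (∀ᵐ x ∂(volume.restrict Ω), r x ∈ Icc 0 (1 / gammaBar d ε)) ∧
      ∀ᵐ x ∂(volume.restrict Ω), b x ∈ Icc 0 (1 / gammaBar d ε) := by
  refine ⟨h.mem.mono fun x hx => ⟨hx.1, ?_⟩, h.mem.mono fun x hx => ⟨hx.2.1, ?_⟩⟩
  · linarith [hx.2.1, hx.2.2]
  · linarith [hx.1, hx.2.2]

theorem IsDensityPair.integrable [IsFiniteMeasure (volume.restrict Ω)]
    {r b : EuclideanSpace ℝ (Fin d) → ℝ} (h : IsDensityPair Ω ε r b) :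
    IntegrableOn r Ω ∧ IntegrableOn b Ω :=
  ⟨integrable_comp_of_mem_Icc continuous_id h.meas_r h.mem_Icc.1,
    integrable_comp_of_mem_Icc continuous_id h.meas_b h.mem_Icc.2⟩

theorem IsDensityPair.integrable_entropyDensity [IsFiniteMeasure (volume.restrict Ω)] (a : ℝ)
    {Vr Vb r b : EuclideanSpace ℝ (Fin d) → ℝ} (hVr : IntegrableOn Vr Ω)
    (hVb : IntegrableOn Vb Ω) (h : IsDensityPair Ω ε r b) :
    IntegrableOn (fun x => entropyDensity a (Vr x) (Vb x) (r x) (b x)) Ω :=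
  HardSpheres.integrable_entropyDensity hVr hVb h.meas_r h.meas_b h.mem_Icc.1 h.mem_Icc.2

theorem IsDensityPair.convexComb {r₁ b₁ r₂ b₂ : EuclideanSpace ℝ (Fin d) → ℝ}
    (h₁ : IsDensityPair Ω ε r₁ b₁) (h₂ : IsDensityPair Ω ε r₂ b₂) {s : ℝ}
    (hs : s ∈ Ioo (0 : ℝ) 1) :
    IsDensityPair Ω ε (fun x => (1 - s) * r₁ x + s * r₂ x) (fun x => (1 - s) * b₁ x + s * b₂ x) where
  meas_r := (h₁.meas_r.const_mul _).add (h₂.meas_r.const_mul _)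
  meas_b := (h₁.meas_b.const_mul _).add (h₂.meas_b.const_mul _)
  mem := by
    filter_upwards [h₁.mem, h₂.mem] with x ⟨p1, p2, p3⟩ ⟨q1, q2, q3⟩
    have h1s : 0 < 1 - s := by linarith [hs.2]
    have hs0 := hs.1
    simp only at p1 p2 p3 q1 q2 q3
    refine ⟨by positivity, by positivity, ?_⟩
    have h1 := mul_le_mul_of_nonneg_left p3 h1s.le
    have h2 := mul_le_mul_of_nonneg_left q3 hs0.le
    simp only
    linarith

theorem entropy_strictConvex [IsFiniteMeasure (volume.restrict Ω)] (ha : 0 < alphaBar d ε)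
    {Vr Vb r₁ b₁ r₂ b₂ : EuclideanSpace ℝ (Fin d) → ℝ}
    (hVr : IntegrableOn Vr Ω) (hVb : IntegrableOn Vb Ω)
    (h₁ : IsDensityPair Ω ε r₁ b₁) (h₂ : IsDensityPair Ω ε r₂ b₂)
    (hne : ¬ (r₁ =ᵐ[volume.restrict Ω] r₂ ∧ b₁ =ᵐ[volume.restrict Ω] b₂))
    {s : ℝ} (hs : s ∈ Ioo (0 : ℝ) 1) :
    entropy Ω ε Vr Vb (fun x => (1 - s) * r₁ x + s * r₂ x) (fun x => (1 - s) * b₁ x + s * b₂ x)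
      < (1 - s) * entropy Ω ε Vr Vb r₁ b₁ + s * entropy Ω ε Vr Vb r₂ b₂ := by
  have i₁ := (h₁.integrable_entropyDensity (alphaBar d ε) hVr hVb).const_mul (1 - s)
  have i₂ := (h₂.integrable_entropyDensity (alphaBar d ε) hVr hVb).const_mul s
  have i₃ := (h₁.convexComb h₂ hs).integrable_entropyDensity (alphaBar d ε) hVr hVb
  have key := (h₁.mem.and h₂.mem).mono fun x p =>
    entropyDensity_convex ha (Vr x) (Vb x) p.1.1 p.1.2.1 p.2.1 p.2.2.1 hs
  have hle := integral_mono_ae i₃ (i₁.add i₂) (key.mono fun x hx => hx.1)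
  have hiff := integral_eq_iff_of_ae_le i₃ (i₁.add i₂) (key.mono fun x hx => hx.1)
  have hsum : ∫ x in Ω, ((fun x => (1 - s) * entropyDensity (alphaBar d ε) (Vr x) (Vb x) (r₁ x)
      (b₁ x)) + fun x => s * entropyDensity (alphaBar d ε) (Vr x) (Vb x) (r₂ x) (b₂ x)) x
      = (1 - s) * entropy Ω ε Vr Vb r₁ b₁ + s * entropy Ω ε Vr Vb r₂ b₂ := by
    simp only [Pi.add_apply]
    rw [integral_add i₁ i₂, integral_const_mul, integral_const_mul]
    rfl
  rw [hsum] at hle hiff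
  refine lt_of_le_of_ne hle fun heq => hne ?_
  have hae := hiff.1 heq
  have h3 : ∀ᵐ x ∂(volume.restrict Ω), r₁ x = r₂ x ∧ b₁ x = b₂ x := by
    filter_upwards [key, hae] with x hx hx' using hx.2 hx'
  exact ⟨h3.mono fun x hx => hx.1, h3.mono fun x hx => hx.2⟩

/-- With constant entropy variables the tangent terms are constants times mass differences, hence
integrate to zero. The entropy gap is therefore the integral of the nonnegative tangent remainder.
-/
theorem entropy_minimizer [IsFiniteMeasure (volume.restrict Ω)] (ha : 0 < alphaBar d ε)
    {Vr Vb r b r' b' : EuclideanSpace ℝ (Fin d) → ℝ} {Nr Nb : ℝ}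
    (hVr : IntegrableOn Vr Ω) (hVb : IntegrableOn Vb Ω)
    (h : IsDensityPair Ω ε r b) (h' : IsDensityPair Ω ε r' b')
    (hpos : ∀ᵐ x ∂(volume.restrict Ω), 0 < r x ∧ 0 < b x)
    (hm : HasMasses Ω Nr Nb r b) (hm' : HasMasses Ω Nr Nb r' b') {c : Fin 2 → ℝ}
    (hc : ∀ i, ∀ᵐ x ∂(volume.restrict Ω), entropyFields ε Vr Vb r b i x = c i) :
    entropy Ω ε Vr Vb r b ≤ entropy Ω ε Vr Vb r' b' ∧
      (entropy Ω ε Vr Vb r' b' = entropy Ω ε Vr Vb r b →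
        r' =ᵐ[volume.restrict Ω] r ∧ b' =ᵐ[volume.restrict Ω] b) := by
  have i₁ := h.integrable_entropyDensity (alphaBar d ε) hVr hVb
  have i₂ := h'.integrable_entropyDensity (alphaBar d ε) hVr hVb
  have jr : IntegrableOn (fun x => (c 0 + 1) * (r' x - r x)) Ω :=
    (h'.integrable.1.sub h.integrable.1).const_mul (c 0 + 1)
  have jb : IntegrableOn (fun x => (c 1 + 1) * (b' x - b x)) Ω :=
    (h'.integrable.2.sub h.integrable.2).const_mul (c 1 + 1)
  have i₂₁ : IntegrableOn (fun x => entropyDensity (alphaBar d ε) (Vr x) (Vb x) (r' x) (b' x)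
      - entropyDensity (alphaBar d ε) (Vr x) (Vb x) (r x) (b x)) Ω := i₂.sub i₁
  have i₂₁' : IntegrableOn (fun x => entropyDensity (alphaBar d ε) (Vr x) (Vb x) (r' x) (b' x)
      - entropyDensity (alphaBar d ε) (Vr x) (Vb x) (r x) (b x)
      - (c 0 + 1) * (r' x - r x)) Ω := i₂₁.sub jr
  have key : ∀ᵐ x ∂(volume.restrict Ω),
      0 ≤ entropyDensity (alphaBar d ε) (Vr x) (Vb x) (r' x) (b' x)
        - entropyDensity (alphaBar d ε) (Vr x) (Vb x) (r x) (b x)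
        - (c 0 + 1) * (r' x - r x) - (c 1 + 1) * (b' x - b x) ∧
      (entropyDensity (alphaBar d ε) (Vr x) (Vb x) (r' x) (b' x)
        - entropyDensity (alphaBar d ε) (Vr x) (Vb x) (r x) (b x)
        - (c 0 + 1) * (r' x - r x) - (c 1 + 1) * (b' x - b x) = 0 → r' x = r x ∧ b' x = b x) := by
    filter_upwards [hpos, h'.mem, hc 0, hc 1] with x p q h0 h1
    have := entropyDensity_tangent ha (Vr x) (Vb x) p.1 p.2 q.1 q.2.1
    rw [← h0, ← h1]
    exact this
  have hval : ∫ x in Ω, (entropyDensity (alphaBar d ε) (Vr x) (Vb x) (r' x) (b' x)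
        - entropyDensity (alphaBar d ε) (Vr x) (Vb x) (r x) (b x)
        - (c 0 + 1) * (r' x - r x) - (c 1 + 1) * (b' x - b x))
      = entropy Ω ε Vr Vb r' b' - entropy Ω ε Vr Vb r b := by
    rw [integral_sub i₂₁' jb, integral_sub i₂₁ jr, integral_sub i₂ i₁,
      integral_const_mul, integral_const_mul, integral_sub h'.integrable.1 h.integrable.1,
      integral_sub h'.integrable.2 h.integrable.2, hm.1, hm.2, hm'.1, hm'.2]
    simp only [sub_self, mul_zero, sub_zero]
    rfl
  refine ⟨?_, fun heq => ?_⟩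
  · have := integral_nonneg_of_ae (key.mono fun x hx => hx.1)
    rw [hval] at this
    linarith
  · rw [heq, sub_self] at hval
    have hae := (integral_eq_zero_iff_of_nonneg_ae (key.mono fun x hx => hx.1) (i₂₁'.sub jb)).1 hval
    have h3 : ∀ᵐ x ∂(volume.restrict Ω), r' x = r x ∧ b' x = b x := by
      filter_upwards [key, hae] with x hx hx' using hx.2 hx'
    exact ⟨h3.mono fun x hx => hx.1, h3.mono fun x hx => hx.2⟩

end Entropy

/-! ### Positive definite matrix fields -/

/-- Bounded measurable fields of positive definite matrices. -/
structure IsPosDefField {d : ℕ} (Ω : Set (EuclideanSpace ℝ (Fin d)))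
    (A : EuclideanSpace ℝ (Fin d) → Matrix (Fin 2) (Fin 2) ℝ) : Prop where
  meas : ∀ i j, AEStronglyMeasurable (fun x => A x i j) (volume.restrict Ω)
  bdd : ∃ K : ℝ, ∀ᵐ x ∂(volume.restrict Ω), ∀ i j, |A x i j| ≤ K
  posDef : ∀ᵐ x ∂(volume.restrict Ω), (A x).PosDef

/-- The Hermitian form of a real symmetric matrix. -/
noncomputable def quad {𝕜 : Type*} [RCLike 𝕜] (A : Matrix (Fin 2) (Fin 2) ℝ) (z : Fin 2 → 𝕜) : ℝ :=
  ∑ i, ∑ j, A i j * (RCLike.re (z j) * RCLike.re (z i) + RCLike.im (z j) * RCLike.im (z i))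

section Pointwise

variable {𝕜 : Type*} [RCLike 𝕜] {A : Matrix (Fin 2) (Fin 2) ℝ}

theorem quad_real (A : Matrix (Fin 2) (Fin 2) ℝ) (z : Fin 2 → ℝ) :
    quad A z = ∑ i, ∑ j, A i j * (z j * z i) := by
  simp [quad]

/-- Symmetry of `A` cancels the imaginary parts of the two off-diagonal terms. -/
theorem sum_smul_mul_conj (hA : A.PosDef) (z : Fin 2 → 𝕜) :
    ∑ i, ∑ j, A i j • (z j * conj (z i)) = ((quad A z : ℝ) : 𝕜) := by
  have h : A 1 0 = A 0 1 := by simpa using hA.isHermitian.apply 0 1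
  simp only [quad, Fin.sum_univ_two, h]
  apply RCLike.ext
  · simp [RCLike.smul_re]
  · simp [RCLike.smul_im]
    ring

theorem quad_eq (A : Matrix (Fin 2) (Fin 2) ℝ) (z : Fin 2 → 𝕜) :
    quad A z = quad A (fun i => RCLike.re (z i)) + quad A (fun i => RCLike.im (z i)) := by
  simp only [quad_real]
  simp only [quad, Fin.sum_univ_two]
  ring

theorem quad_real_eq (A : Matrix (Fin 2) (Fin 2) ℝ) (z : Fin 2 → ℝ) :
    quad A z = star z ⬝ᵥ (A.mulVec z) := by
  simp [quad_real, dotProduct, Matrix.mulVec, Fin.sum_univ_two]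
  ring

theorem quad_real_nonneg (hA : A.PosDef) (z : Fin 2 → ℝ) : 0 ≤ quad A z := by
  rw [quad_real_eq]
  exact hA.posSemidef.dotProduct_mulVec_nonneg z

theorem quad_nonneg (hA : A.PosDef) (z : Fin 2 → 𝕜) : 0 ≤ quad A z := by
  rw [quad_eq]
  exact add_nonneg (quad_real_nonneg hA _) (quad_real_nonneg hA _)

theorem quad_real_eq_zero (hA : A.PosDef) {z : Fin 2 → ℝ} (h : quad A z = 0) : z = 0 := by
  by_contra hz
  rw [quad_real_eq] at h
  exact (hA.dotProduct_mulVec_pos hz).ne' h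

theorem quad_eq_zero (hA : A.PosDef) {z : Fin 2 → 𝕜} (h : quad A z = 0) : z = 0 := by
  rw [quad_eq] at h
  have h1 := quad_real_nonneg hA (fun i => RCLike.re (z i))
  have h2 := quad_real_nonneg hA (fun i => RCLike.im (z i))
  have h3 := quad_real_eq_zero hA (le_antisymm (by linarith) h1)
  have h4 := quad_real_eq_zero hA (le_antisymm (by linarith) h2)
  ext i
  exact RCLike.ext (by simpa using congrFun h3 i) (by simpa using congrFun h4 i)

theorem sum_smul_sum_mul_conj {d : ℕ} (hA : A.PosDef) (G : Fin 2 → Fin d → 𝕜) :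
    ∑ i, ∑ j, A i j • (∑ k, G j k * conj (G i k))
      = ((∑ k, quad A (fun i => G i k) : ℝ) : 𝕜) := by
  rw [RCLike.ofReal_sum]
  simp only [← sum_smul_mul_conj hA, Finset.smul_sum, Fin.sum_univ_two, Finset.sum_add_distrib]

end Pointwise

section Forms

variable {d : ℕ} {Ω : Set (EuclideanSpace ℝ (Fin d))} {𝕜 : Type*} [RCLike 𝕜]
  {A : EuclideanSpace ℝ (Fin d) → Matrix (Fin 2) (Fin 2) ℝ}

theorem IsPosDefField.integrable_smul (hA : IsPosDefField Ω A) {f : EuclideanSpace ℝ (Fin d) → 𝕜}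
    (hf : IntegrableOn f Ω) (i j : Fin 2) : IntegrableOn (fun x => A x i j • f x) Ω := by
  obtain ⟨K, hK⟩ := hA.bdd
  exact hf.bdd_smul K (hA.meas i j) (hK.mono fun x hx => hx i j)

theorem IsPosDefField.integrable_smul_mul (hA : IsPosDefField Ω A)
    {f g : EuclideanSpace ℝ (Fin d) → 𝕜} (hf : MemLp f 2 (volume.restrict Ω))
    (hg : MemLp g 2 (volume.restrict Ω)) (i j : Fin 2) :
    IntegrableOn (fun x => A x i j • (f x * g x)) Ω :=
  hA.integrable_smul (hf.integrable_mul hg) i j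

theorem memLp_conj {f : EuclideanSpace ℝ (Fin d) → 𝕜} (hf : MemLp f 2 (volume.restrict Ω)) :
    MemLp (fun x => conj (f x)) 2 (volume.restrict Ω) :=
  hf.star

theorem integrable_quad (hA : IsPosDefField Ω A) {ζ : Fin 2 → EuclideanSpace ℝ (Fin d) → 𝕜}
    (hζ : ∀ i, MemLp (ζ i) 2 (volume.restrict Ω)) :
    IntegrableOn (fun x => quad (A x) (fun i => ζ i x)) Ω := by
  have h : IntegrableOn (fun x => ∑ i, ∑ j, A x i j • (ζ j x * conj (ζ i x))) Ω :=
    integrable_finsetSum _ fun i _ => integrable_finsetSum _ fun j _ =>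
      hA.integrable_smul_mul (hζ j) (memLp_conj (hζ i)) i j
  refine h.re.congr (hA.posDef.mono fun x hx => ?_)
  simp only [sum_smul_mul_conj hx, RCLike.ofReal_re]

theorem massForm_conj (hA : IsPosDefField Ω A) (ζ : Fin 2 → EuclideanSpace ℝ (Fin d) → 𝕜) :
    massForm Ω A ζ (fun i x => conj (ζ i x))
      = ((∫ x in Ω, quad (A x) (fun i => ζ i x) : ℝ) : 𝕜) := by
  rw [massForm, ← integral_ofReal]
  exact integral_congr_ae (hA.posDef.mono fun x hx => sum_smul_mul_conj hx _)

theorem gradForm_conj (hA : IsPosDefField Ω A)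
    (G : Fin 2 → Fin d → EuclideanSpace ℝ (Fin d) → 𝕜) :
    gradForm Ω A G (fun i k x => conj (G i k x))
      = ((∫ x in Ω, ∑ k, quad (A x) (fun i => G i k x) : ℝ) : 𝕜) := by
  rw [gradForm, ← integral_ofReal]
  exact integral_congr_ae (hA.posDef.mono fun x hx =>
    sum_smul_sum_mul_conj hx (fun i k => G i k x))

theorem integral_quad_nonneg (hA : IsPosDefField Ω A)
    (ζ : Fin 2 → EuclideanSpace ℝ (Fin d) → 𝕜) :
    0 ≤ ∫ x in Ω, quad (A x) (fun i => ζ i x) :=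
  integral_nonneg_of_ae (hA.posDef.mono fun _ hx => quad_nonneg hx _)

theorem ae_eq_zero_of_integral_quad (hA : IsPosDefField Ω A)
    {ζ : Fin 2 → EuclideanSpace ℝ (Fin d) → 𝕜} (hζ : ∀ i, MemLp (ζ i) 2 (volume.restrict Ω))
    (h : ∫ x in Ω, quad (A x) (fun i => ζ i x) = 0) (i : Fin 2) :
    ζ i =ᵐ[volume.restrict Ω] 0 := by
  have h1 := (integral_eq_zero_iff_of_nonneg_ae (hA.posDef.mono fun _ hx => quad_nonneg hx _)
    (integrable_quad hA hζ)).1 h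
  filter_upwards [hA.posDef, h1] with x hx hx'
  exact congrFun (quad_eq_zero hx hx') i

theorem integral_sum_quad_nonneg (hA : IsPosDefField Ω A)
    (G : Fin 2 → Fin d → EuclideanSpace ℝ (Fin d) → 𝕜) :
    0 ≤ ∫ x in Ω, ∑ k, quad (A x) (fun i => G i k x) :=
  integral_nonneg_of_ae (hA.posDef.mono fun _ hx => Finset.sum_nonneg fun _ _ => quad_nonneg hx _)

theorem ae_eq_zero_of_integral_sum_quad (hA : IsPosDefField Ω A)
    {G : Fin 2 → Fin d → EuclideanSpace ℝ (Fin d) → 𝕜}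
    (hG : ∀ i k, MemLp (G i k) 2 (volume.restrict Ω))
    (h : ∫ x in Ω, ∑ k, quad (A x) (fun i => G i k x) = 0) (i : Fin 2) (k : Fin d) :
    G i k =ᵐ[volume.restrict Ω] 0 := by
  rw [integral_finsetSum _ fun k _ => integrable_quad hA fun i => hG i k] at h
  exact ae_eq_zero_of_integral_quad hA (fun i => hG i k)
    ((Finset.sum_eq_zero_iff_of_nonneg fun k _ =>
      integral_quad_nonneg hA fun i => G i k).1 h k (Finset.mem_univ k)) i

end Forms

/-! ### Weak gradients -/

section Gradient

variable {d : ℕ} {Ω : Set (EuclideanSpace ℝ (Fin d))} {𝕜 : Type*} [RCLike 𝕜]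

theorem IsH1With.conj {f : EuclideanSpace ℝ (Fin d) → 𝕜}
    {g : Fin d → EuclideanSpace ℝ (Fin d) → 𝕜} (h : IsH1With Ω f g) :
    IsH1With Ω (fun x => conj (f x)) (fun k x => conj (g k x)) where
  memLp := memLp_conj h.memLp
  memLp_grad k := memLp_conj (h.memLp_grad k)
  weakGradient i φ hφ hφc hφΩ := by
    have h1 := congrArg (starRingEnd 𝕜) (h.weakGradient i φ hφ hφc hφΩ)
    rw [map_neg, ← integral_conj, ← integral_conj] at h1
    simpa only [RCLike.real_smul_eq_coe_mul, map_mul, RCLike.conj_ofReal] using h1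

theorem IsH1With.ae_const [IsFiniteMeasure (volume.restrict Ω)] (hΩ : IsOpen Ω)
    (hc : IsConnected Ω) {f : EuclideanSpace ℝ (Fin d) → 𝕜}
    {g : Fin d → EuclideanSpace ℝ (Fin d) → 𝕜} (h : IsH1With Ω f g)
    (hg : ∀ k, g k =ᵐ[volume.restrict Ω] 0) : ∃ c : 𝕜, ∀ᵐ x ∂(volume.restrict Ω), f x = c := by
  refine ae_const_of_weakGradient_zero hΩ hc (h.memLp.integrable (by norm_num)) ?_
  intro i φ hφ hφc hφΩ
  rw [h.weakGradient i φ hφ hφc hφΩ]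
  congr 1
  refine integral_congr_ae ((hg i).mono fun x hx => ?_)
  simp only [hx, Pi.zero_apply]

theorem isH1With_zero_of_ae_const [IsFiniteMeasure (volume.restrict Ω)]
    {f : EuclideanSpace ℝ (Fin d) → 𝕜} {c : 𝕜}
    (hf : ∀ᵐ x ∂(volume.restrict Ω), f x = c) : IsH1With Ω f 0 where
  memLp := (memLp_const c).ae_eq (hf.mono fun _ hx => hx.symm)
  memLp_grad _ := MemLp.zero
  weakGradient := hasWeakGradient_zero_of_ae_const hf

end Gradient

/-! ### Eigenvalues -/

/-- Testing with the conjugate eigenfunction gives `lam = -g / m` with `m > 0` and `g ≥ 0`; `g = 0`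
forces vanishing gradients. -/
theorem IsEigenpair.eigenvalue {d : ℕ} {Ω : Set (EuclideanSpace ℝ (Fin d))} (hΩ : IsOpen Ω)
    (hc : IsConnected Ω) [IsFiniteMeasure (volume.restrict Ω)]
    {A M : EuclideanSpace ℝ (Fin d) → Matrix (Fin 2) (Fin 2) ℝ}
    (hA : IsPosDefField Ω A) (hM : IsPosDefField Ω M) {lam : ℂ}
    {ζ : Fin 2 → EuclideanSpace ℝ (Fin d) → ℂ} (h : IsEigenpair Ω A M lam ζ) :
    lam.im = 0 ∧ lam.re ≤ 0 ∧
      (lam = 0 ↔ ∃ c : Fin 2 → ℂ, ∀ i, ∀ᵐ x ∂(volume.restrict Ω), ζ i x = c i) ∧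
      (IsMassPreserving Ω A ζ → lam.re < 0) := by
  obtain ⟨G, hG, hw⟩ := h.weak
  have hζ : ∀ i, MemLp (ζ i) 2 (volume.restrict Ω) := fun i => (hG i).memLp
  have hw1 := hw _ _ fun i => (hG i).conj
  rw [massForm_conj hA, gradForm_conj hM] at hw1
  set m := ∫ x in Ω, quad (A x) (fun i => ζ i x) with hm
  set g := ∫ x in Ω, ∑ k, quad (M x) (fun i => G i k x) with hg
  have hm0 : m ≠ 0 := fun h0 => h.ne_zero (ae_eq_zero_of_integral_quad hA hζ h0)
  have hmpos : 0 < m := lt_of_le_of_ne (integral_quad_nonneg hA ζ) hm0.symm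
  have hgn : 0 ≤ g := integral_sum_quad_nonneg hM G
  have hlam : lam = ((-(g / m) : ℝ) : ℂ) := by
    have hmC : (m : ℂ) ≠ 0 := by exact_mod_cast hm0
    have : lam * (m : ℂ) = -(g : ℂ) := hw1
    push_cast
    field_simp
    exact this
  have hiff : lam = 0 ↔ ∃ c : Fin 2 → ℂ, ∀ i, ∀ᵐ x ∂(volume.restrict Ω), ζ i x = c i := by
    constructor
    · intro h0
      have hg0 : g = 0 := by
        rw [h0] at hw1
        simpa using hw1
      have hG0 := ae_eq_zero_of_integral_sum_quad hM (fun i k => (hG i).memLp_grad k) hg0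
      choose c hc' using fun i => (hG i).ae_const hΩ hc (hG0 i)
      exact ⟨c, hc'⟩
    · rintro ⟨c, hc'⟩
      -- A constant test function may be paired with the gradient `0`, so the right-hand side
      -- vanishes whatever representative `G` is.
      have h0 := hw (fun i x => conj (ζ i x)) (fun _ => 0) fun i =>
        isH1With_zero_of_ae_const (c := conj (c i)) ((hc' i).mono fun x hx => by rw [hx])
      rw [massForm_conj hA] at h0
      have : gradForm Ω M G (fun _ => 0) = 0 := by simp [gradForm]
      rw [this, neg_zero, mul_eq_zero] at h0
      exact h0.resolve_right (Complex.ofReal_ne_zero.2 hm0)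
  have hre : lam.re ≤ 0 := by
    rw [hlam, Complex.ofReal_re]
    exact neg_nonpos.2 (div_nonneg hgn hmpos.le)
  have him : lam.im = 0 := by rw [hlam, Complex.ofReal_im]
  refine ⟨him, hre, hiff, fun hmass => lt_of_le_of_ne hre fun hre0 => ?_⟩
  obtain ⟨c, hc'⟩ := hiff.1 (Complex.ext hre0 him)
  -- For constant `ζ = c` the square norm `m` is `∑ i, conj (c i) ∫ (A ζ) i`, which mass
  -- preservation makes zero.
  refine hm0 ?_
  have h1 := massForm_conj hA ζ
  have h2 : massForm Ω A ζ (fun i x => conj (ζ i x))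
      = ∑ i, (∫ x in Ω, ∑ j, A x i j • ζ j x) * conj (c i) := by
    simp only [← integral_mul_const]
    rw [← integral_finsetSum]
    · refine integral_congr_ae ((ae_all_iff.2 hc').mono fun x hx => ?_)
      refine Finset.sum_congr rfl fun i _ => ?_
      rw [Finset.sum_mul]
      exact Finset.sum_congr rfl fun j _ => by
        rw [← hx i]
        exact (smul_mul_assoc _ _ _).symm
    · exact fun i _ => (integrable_finsetSum _ fun j _ =>
        hA.integrable_smul ((hζ j).integrable (by norm_num)) i j).mul_const _
  simp only [hmass _, zero_mul, Finset.sum_const_zero] at h2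
  rw [h2] at h1
  exact Complex.ofReal_eq_zero.1 h1.symm

/-! ### Energy decay from an integrated energy inequality -/

section Decay

/-- The square splits along the null diagonal into two triangles, exchanged by Fubini and the
symmetry of `k`. -/
theorem setIntegral_triangle_eq_half {k : ℝ → ℝ → ℝ} {s τ : ℝ} (hsτ : s ≤ τ)
    (hk : Integrable (fun q : ℝ × ℝ => k q.1 q.2)
      ((volume.restrict (Ioc s τ)).prod (volume.restrict (Ioc s τ))))
    (hsymm : ∀ σ t, k σ t = k t σ) :
    IntervalIntegrable (fun t => ∫ σ in s..t, k σ t) volume s τ ∧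
      2 * ∫ t in s..τ, ∫ σ in s..t, k σ t = ∫ t in s..τ, ∫ σ in s..τ, k σ t := by
  set ν := volume.restrict (Ioc s τ) with hν
  let L : ℝ → ℝ → ℝ := fun t σ => if σ ≤ t then k σ t else 0
  let U : ℝ → ℝ → ℝ := fun t σ => if t ≤ σ then k σ t else 0
  have hk' : Integrable (fun q : ℝ × ℝ => k q.2 q.1) (ν.prod ν) := hk.swap
  have hL : Integrable (fun q : ℝ × ℝ => L q.1 q.2) (ν.prod ν) := by
    refine (hk'.indicator (measurableSet_le measurable_snd measurable_fst)).congr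
      (Eventually.of_forall fun q => ?_)
    simp [L, indicator_apply]
  have hU : Integrable (fun q : ℝ × ℝ => U q.1 q.2) (ν.prod ν) := by
    refine (hk'.indicator (measurableSet_le measurable_fst measurable_snd)).congr
      (Eventually.of_forall fun q => ?_)
    simp [U, indicator_apply]
  have hLeq : ∀ t ∈ Ioc s τ, ∫ σ in s..t, k σ t = ∫ σ, L t σ ∂ν := fun t ht => by
    rw [intervalIntegral.integral_of_le ht.1.le, hν]
    have : (fun σ => L t σ) = (Iic t).indicator (fun σ => k σ t) := by
      ext σ
      simp [L, indicator_apply]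
    rw [this, integral_indicator measurableSet_Iic, Measure.restrict_restrict measurableSet_Iic]
    congr 2
    ext σ
    simp only [mem_Ioc, mem_inter_iff, mem_Iic]
    exact ⟨fun h => ⟨h.2, h.1, h.2.trans ht.2⟩, fun h => ⟨h.2.1, h.1⟩⟩
  have hLi : Integrable (fun t => ∫ σ, L t σ ∂ν) ν := hL.integral_prod_left
  have hUi : Integrable (fun t => ∫ σ, U t σ ∂ν) ν := hU.integral_prod_left
  have hLU : ∫ t, ∫ σ, L t σ ∂ν ∂ν = ∫ t, ∫ σ, U t σ ∂ν ∂ν := by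
    rw [integral_integral_swap hL]
    refine integral_congr_ae (Eventually.of_forall fun t => integral_congr_ae
      (Eventually.of_forall fun σ => ?_))
    simp only [L, U, hsymm σ t]
  have hsum : ∀ᵐ t ∂ν, ∫ σ, k σ t ∂ν = ∫ σ, L t σ ∂ν + ∫ σ, U t σ ∂ν := by
    filter_upwards [hL.prod_right_ae, hU.prod_right_ae] with t h1 h2
    rw [← integral_add h1 h2]
    have hne : ∀ᵐ σ ∂ν, σ ≠ t := by simp [ae_iff, measure_singleton]
    refine integral_congr_ae (hne.mono fun σ hσ => ?_)
    rcases lt_or_gt_of_ne hσ with h | h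
    · simp [L, U, h.le, h.not_ge]
    · simp [L, U, h.le, h.not_ge]
  have hcongr : ∀ᵐ t ∂ν, ∫ σ in s..t, k σ t = ∫ σ, L t σ ∂ν := by
    filter_upwards [ae_restrict_mem measurableSet_Ioc] with t ht using hLeq t ht
  constructor
  · rw [intervalIntegrable_iff_integrableOn_Ioc_of_le hsτ]
    exact hLi.congr (hcongr.mono fun t ht => ht.symm)
  · simp only [intervalIntegral.integral_of_le hsτ]
    change 2 * ∫ t, (∫ σ in s..t, k σ t) ∂ν = ∫ t, ∫ σ, k σ t ∂ν ∂ν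
    rw [integral_congr_ae hcongr, integral_congr_ae hsum, integral_add hLi hUi, ← hLU]
    ring

variable {T : ℝ} {F : ℝ → ℝ} {k : ℝ → ℝ → ℝ}

/-- Integrating the hypothesis over `(s,τ)` leaves minus the integral of `k` over a square, which is
nonpositive although the pointwise right-hand side has no sign. -/
theorem integral_le_of_energy_inequality (hF : IntervalIntegrable F volume 0 T)
    (hk : Integrable (fun q : ℝ × ℝ => k q.1 q.2)
      ((volume.restrict (Ioo 0 T)).prod (volume.restrict (Ioo 0 T))))
    (hsymm : ∀ σ t, k σ t = k t σ)
    (hpos : ∀ s τ, 0 ≤ s → s ≤ τ → τ < T → 0 ≤ ∫ t in s..τ, ∫ σ in s..τ, k σ t)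
    {s τ c : ℝ} (hs : 0 ≤ s) (hsτ : s ≤ τ) (hτ : τ < T)
    (h : ∀ᵐ t ∂(volume.restrict (Ioo 0 T)), s < t → F t - c ≤ -2 * ∫ σ in s..t, k σ t) :
    ∫ t in s..τ, F t ≤ (τ - s) * c := by
  have hsub : Ioc s τ ⊆ Ioo 0 T := fun t ht => ⟨hs.trans_lt ht.1, ht.2.trans_lt hτ⟩
  have hk' : Integrable (fun q : ℝ × ℝ => k q.1 q.2)
      ((volume.restrict (Ioc s τ)).prod (volume.restrict (Ioc s τ))) := by
    rw [Measure.prod_restrict] at hk ⊢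
    exact IntegrableOn.mono_set hk (prod_mono hsub hsub)
  obtain ⟨hi, heq⟩ := setIntegral_triangle_eq_half hsτ hk' hsymm
  have hFi : IntervalIntegrable F volume s τ := hF.mono_set (by
    rw [uIcc_of_le hsτ, uIcc_of_le (hs.trans (hsτ.trans hτ.le))]
    exact Icc_subset_Icc hs hτ.le)
  have h1 : ∫ t in s..τ, (F t - c) ≤ ∫ t in s..τ, -2 * ∫ σ in s..t, k σ t := by
    rw [intervalIntegral.integral_of_le hsτ, intervalIntegral.integral_of_le hsτ]
    refine setIntegral_mono_ae_restrict (hFi.sub intervalIntegrable_const).1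
      (hi.const_mul (-2)).1 ?_
    filter_upwards [ae_mono (Measure.restrict_mono hsub le_rfl) h,
      ae_restrict_mem measurableSet_Ioc] with t ht hts using ht hts.1
  rw [intervalIntegral.integral_sub hFi intervalIntegrable_const,
    intervalIntegral.integral_const_mul, intervalIntegral.integral_const, smul_eq_mul] at h1
  have := hpos s τ hs hsτ hτ
  linarith

/-- The mean `(∫_s^τ F) / (τ - s)` has derivative `(∫_s^τ F - (τ - s) F(s)) / (τ - s)² ≤ 0` for a.e.
`s`. It is absolutely continuous away from `τ`, hence nonincreasing, so its value at `x` is at most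
its value at `0`. -/
theorem integral_le_of_average_le {τ c : ℝ} (hτ : 0 < τ) (hF : IntervalIntegrable F volume 0 τ)
    (h0 : ∫ t in 0..τ, F t ≤ τ * c)
    (h : ∀ᵐ s, s ∈ Ioo 0 τ → ∫ t in s..τ, F t ≤ (τ - s) * F s) {x : ℝ} (hx : x ∈ Ico 0 τ) :
    ∫ t in x..τ, F t ≤ (τ - x) * c := by
  have hxτ : uIcc 0 x ⊆ uIcc 0 τ := by
    rw [uIcc_of_le hx.1, uIcc_of_le hτ.le]
    exact Icc_subset_Icc_right hx.2.le
  have hAC : AbsolutelyContinuousOnInterval (fun s => ∫ t in τ..s, F t) 0 x :=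
    (hF.absolutelyContinuousOnInterval_intervalIntegral right_mem_uIcc).mono hxτ
  have hne : ∀ s ∈ uIcc 0 x, τ - s ≠ 0 := fun s hs => by
    rw [uIcc_of_le hx.1] at hs
    linarith [hs.2, hx.2]
  have hg : AbsolutelyContinuousOnInterval (fun s : ℝ => (τ - s)⁻¹) 0 x := by
    refine ContDiffOn.absolutelyContinuousOnInterval ?_
    exact (contDiffOn_const.sub contDiffOn_id).inv hne
  have hint := AbsolutelyContinuousOnInterval.integral_deriv_mul_eq_sub hAC hg
  have hnonneg : 0 ≤ ∫ s in 0..x, deriv (fun s => ∫ t in τ..s, F t) s * (τ - s)⁻¹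
      + (∫ t in τ..s, F t) * deriv (fun s : ℝ => (τ - s)⁻¹) s := by
    refine intervalIntegral.integral_nonneg_of_ae_restrict hx.1 ?_
    rw [EventuallyLE, ae_restrict_iff' measurableSet_Icc]
    -- The averaged inequality is assumed on the open interval only, while the integral includes the
    -- endpoint `0`.
    have h00 : ∀ᵐ s : ℝ, s ≠ 0 := by simp [ae_iff, measure_singleton]
    filter_upwards [h, hF.ae_hasDerivAt_integral, h00] with s hs hd hs0 hsx
    have hsx' : s ∈ uIcc 0 x := by rwa [uIcc_of_le hx.1]
    have hsτ : s < τ := hsx.2.trans_lt hx.2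
    have hs1 := hs ⟨lt_of_le_of_ne hsx.1 hs0.symm, hsτ⟩
    rw [(hd (hxτ hsx') τ right_mem_uIcc).deriv]
    have hd2 : deriv (fun s : ℝ => (τ - s)⁻¹) s = (τ - s)⁻¹ * (τ - s)⁻¹ := by
      have := (((hasDerivAt_id s).const_sub τ).inv (hne s hsx')).deriv
      simp only [id] at this
      refine this.trans ?_
      have := hne s hsx'
      field_simp
    rw [hd2, intervalIntegral.integral_symm]
    have hpos : 0 < τ - s := by linarith
    have : F s * (τ - s)⁻¹ + -(∫ t in s..τ, F t) * ((τ - s)⁻¹ * (τ - s)⁻¹)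
        = ((τ - s) * F s - ∫ t in s..τ, F t) * ((τ - s)⁻¹ * (τ - s)⁻¹) := by
      field_simp
      ring
    rw [Pi.zero_apply, this]
    exact mul_nonneg (by linarith) (by positivity)
  rw [hint, intervalIntegral.integral_symm, intervalIntegral.integral_symm 0, sub_zero] at hnonneg
  have hpos : 0 < τ - x := by linarith [hx.2]
  have h2 : (∫ t in x..τ, F t) / (τ - x) ≤ (∫ t in 0..τ, F t) / τ := by
    rw [div_eq_mul_inv, div_eq_mul_inv]
    linarith
  have h3 : (∫ t in 0..τ, F t) / τ ≤ c := by
    rw [div_le_iff₀ hτ]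
    linarith
  rw [div_le_iff₀ hpos] at h2
  nlinarith

/-- An integrable function satisfying an energy inequality with a positive semidefinite symmetric
kernel is bounded by its initial value. -/
theorem ae_le_of_energy_inequality (hT : 0 < T) (hF : IntervalIntegrable F volume 0 T)
    (hk : Integrable (fun q : ℝ × ℝ => k q.1 q.2)
      ((volume.restrict (Ioo 0 T)).prod (volume.restrict (Ioo 0 T))))
    (hsymm : ∀ σ t, k σ t = k t σ)
    (hpos : ∀ s τ, 0 ≤ s → s ≤ τ → τ < T → 0 ≤ ∫ t in s..τ, ∫ σ in s..τ, k σ t) {c : ℝ}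
    (h0 : ∀ᵐ t ∂(volume.restrict (Ioo 0 T)), F t - c ≤ -2 * ∫ σ in 0..t, k σ t)
    (h : ∀ᵐ s ∂(volume.restrict (Ioo 0 T)), ∀ᵐ t ∂(volume.restrict (Ioo 0 T)),
      s < t → F t - F s ≤ -2 * ∫ σ in s..t, k σ t) :
    ∀ᵐ t ∂(volume.restrict (Ioo 0 T)), F t ≤ c := by
  have hmono : ∀ {τ}, 0 < τ → τ < T → IntervalIntegrable F volume 0 τ := fun {τ} h1 h2 =>
    hF.mono_set (by
      rw [uIcc_of_le h1.le, uIcc_of_le hT.le]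
      exact Icc_subset_Icc_right h2.le)
  have key : ∀ x τ, 0 ≤ x → x < τ → τ < T → ∫ t in x..τ, F t ≤ (τ - x) * c := by
    intro x τ hx hxτ hτ
    have hτ0 : 0 < τ := hx.trans_lt hxτ
    refine integral_le_of_average_le hτ0 (hmono hτ0 hτ) ?_ ?_ ⟨hx, hxτ⟩
    · simpa using integral_le_of_energy_inequality hF hk hsymm hpos le_rfl hτ0.le hτ
        (h0.mono fun t ht _ => ht)
    · rw [ae_restrict_iff' measurableSet_Ioo] at h
      filter_upwards [h] with s hs hsτ
      exact integral_le_of_energy_inequality hF hk hsymm hpos hsτ.1.le hsτ.2.le hτ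
        (hs ⟨hsτ.1, hsτ.2.trans hτ⟩)
  rw [ae_restrict_iff' measurableSet_Ioo]
  filter_upwards [hF.ae_hasDerivAt_integral] with t ht htT
  rw [uIcc_of_le hT.le] at ht
  have hd := (ht (Ioo_subset_Icc_self htT) 0 ⟨le_rfl, hT.le⟩)
  -- Lebesgue differentiation: the means over `(t,τ)`, all at most `c`, tend to `F t` as `τ`
  -- decreases to `t`.
  have htend := hd.tendsto_slope.mono_left (nhdsGT_le_nhdsNE t)
  refine le_of_tendsto htend ?_
  filter_upwards [Ioo_mem_nhdsGT htT.2] with τ hτ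
  rw [slope_def_field, div_le_iff₀ (by linarith [hτ.1]),
    intervalIntegral.integral_interval_sub_left (hmono (htT.1.trans hτ.1) hτ.2)
      (hmono htT.1 htT.2)]
  linarith [key t τ htT.1.le hτ.1 hτ.2]

end Decay

/-! ### Linear stability -/

section Kernel

variable {d : ℕ} {Ω : Set (EuclideanSpace ℝ (Fin d))}
  {A M : EuclideanSpace ℝ (Fin d) → Matrix (Fin 2) (Fin 2) ℝ}
  {G : Fin 2 → Fin d → ℝ → EuclideanSpace ℝ (Fin d) → ℝ} {μ : Measure ℝ}

theorem gradForm_symm (hM : IsPosDefField Ω M)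
    (G H : Fin 2 → Fin d → EuclideanSpace ℝ (Fin d) → ℝ) :
    gradForm Ω M G H = gradForm Ω M H G := by
  refine integral_congr_ae (hM.posDef.mono fun x hx => ?_)
  have h : M x 1 0 = M x 0 1 := by simpa using hx.isHermitian.apply 0 1
  simp only [Fin.sum_univ_two, h, mul_comm (G _ _ _)]
  ring

theorem massForm_self (ζ : Fin 2 → EuclideanSpace ℝ (Fin d) → ℝ) :
    massForm Ω A ζ ζ = ∫ x in Ω, quad (A x) (fun i => ζ i x) := by
  simp only [massForm, quad_real, smul_eq_mul]

theorem massForm_le (hA : IsPosDefField Ω A) {ζ ψ : Fin 2 → EuclideanSpace ℝ (Fin d) → ℝ}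
    (hζ : ∀ i, MemLp (ζ i) 2 (volume.restrict Ω)) (hψ : ∀ i, MemLp (ψ i) 2 (volume.restrict Ω)) :
    2 * massForm Ω A ζ ψ ≤ massForm Ω A ζ ζ + massForm Ω A ψ ψ := by
  rw [massForm_self, massForm_self, massForm, ← integral_const_mul,
    ← integral_add (integrable_quad hA hζ) (integrable_quad hA hψ)]
  refine integral_mono_ae ?_ ((integrable_quad hA hζ).add (integrable_quad hA hψ))
    (hA.posDef.mono fun x hx => ?_)
  · exact (integrable_finsetSum _ fun i _ => integrable_finsetSum _ fun j _ =>
      hA.integrable_smul_mul (hζ j) (hψ i) i j).const_mul 2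
  · have h : A x 1 0 = A x 0 1 := by simpa using hx.isHermitian.apply 0 1
    have h1 := quad_real_nonneg hx (fun i => ζ i x - ψ i x)
    simp only [quad_real, Fin.sum_univ_two, h, smul_eq_mul] at h1 ⊢
    linarith

/-- An extra time variable of finite total measure preserves square integrability. This makes
products of gradients at two different times integrable. -/
theorem memLp_fst_snd [IsFiniteMeasure μ] {f : ℝ → EuclideanSpace ℝ (Fin d) → ℝ}
    (hf : MemLp (fun q : ℝ × EuclideanSpace ℝ (Fin d) => f q.1 q.2) 2
      (μ.prod (volume.restrict Ω))) :
    MemLp (fun q : (ℝ × ℝ) × EuclideanSpace ℝ (Fin d) => f q.1.2 q.2) 2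
      ((μ.prod μ).prod (volume.restrict Ω)) ∧
    MemLp (fun q : (ℝ × ℝ) × EuclideanSpace ℝ (Fin d) => f q.1.1 q.2) 2
      ((μ.prod μ).prod (volume.restrict Ω)) := by
  have h := (hf.comp_snd μ).comp_measurePreserving
    (measurePreserving_prodAssoc μ μ (volume.restrict Ω))
  refine ⟨h, ?_⟩
  exact h.comp_measurePreserving ((Measure.measurePreserving_swap (μ := μ) (ν := μ)).prod
    (MeasurePreserving.id (volume.restrict Ω)))

theorem integrable_kernel [IsFiniteMeasure μ] (hM : IsPosDefField Ω M)
    (hG : ∀ i k, MemLp (fun q : ℝ × EuclideanSpace ℝ (Fin d) => G i k q.1 q.2) 2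
      (μ.prod (volume.restrict Ω))) :
    Integrable (fun q : (ℝ × ℝ) × EuclideanSpace ℝ (Fin d) =>
      ∑ i, ∑ j, M q.2 i j • (∑ k, G j k q.1.1 q.2 * G i k q.1.2 q.2))
      ((μ.prod μ).prod (volume.restrict Ω)) := by
  obtain ⟨K, hK⟩ := hM.bdd
  refine integrable_finsetSum _ fun i _ => integrable_finsetSum _ fun j _ => ?_
  have h : Integrable (fun q : (ℝ × ℝ) × EuclideanSpace ℝ (Fin d) =>
      ∑ k, G j k q.1.1 q.2 * G i k q.1.2 q.2) ((μ.prod μ).prod (volume.restrict Ω)) :=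
    integrable_finsetSum _ fun k _ =>
      (memLp_fst_snd (hG j k)).2.integrable_mul (memLp_fst_snd (hG i k)).1
  exact h.bdd_smul K (hM.meas i j).comp_snd
    ((Measure.quasiMeasurePreserving_snd.ae hK).mono fun q hq => hq i j)

theorem integrable_gradForm [IsFiniteMeasure μ] (hM : IsPosDefField Ω M)
    (hG : ∀ i k, MemLp (fun q : ℝ × EuclideanSpace ℝ (Fin d) => G i k q.1 q.2) 2
      (μ.prod (volume.restrict Ω))) :
    Integrable (fun q : ℝ × ℝ => gradForm Ω M (fun i k => G i k q.1) (fun i k => G i k q.2))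
      (μ.prod μ) :=
  (integrable_kernel hM hG).integral_prod_left

theorem integrable_massForm [SFinite μ] (hA : IsPosDefField Ω A)
    {ζ : Fin 2 → ℝ → EuclideanSpace ℝ (Fin d) → ℝ}
    (hζ : ∀ i, MemLp (fun q : ℝ × EuclideanSpace ℝ (Fin d) => ζ i q.1 q.2) 2
      (μ.prod (volume.restrict Ω))) :
    Integrable (fun t => massForm Ω A (fun i => ζ i t) (fun i => ζ i t)) μ := by
  obtain ⟨K, hK⟩ := hA.bdd
  have h : Integrable (fun q : ℝ × EuclideanSpace ℝ (Fin d) =>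
      ∑ i, ∑ j, A q.2 i j • (ζ j q.1 q.2 * ζ i q.1 q.2)) (μ.prod (volume.restrict Ω)) := by
    refine integrable_finsetSum _ fun i _ => integrable_finsetSum _ fun j _ => ?_
    exact ((hζ j).integrable_mul (hζ i)).bdd_smul K (hA.meas i j).comp_snd
      ((Measure.quasiMeasurePreserving_snd.ae hK).mono fun q hq => hq i j)
  exact h.integral_prod_left

/-- Since `M` does not depend on time, Fubini moves both time integrals inside: the result is the
dissipation of the time-integrated gradient. -/
theorem integral_gradForm_nonneg [IsFiniteMeasure μ] [IsFiniteMeasure (volume.restrict Ω)] (hM : IsPosDefField Ω M)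
    (hG : ∀ i k, MemLp (fun q : ℝ × EuclideanSpace ℝ (Fin d) => G i k q.1 q.2) 2
      (μ.prod (volume.restrict Ω))) :
    0 ≤ ∫ t, ∫ σ, gradForm Ω M (fun i k => G i k σ) (fun i k => G i k t) ∂μ ∂μ := by
  have h1 : ∫ t, ∫ σ, gradForm Ω M (fun i k => G i k σ) (fun i k => G i k t) ∂μ ∂μ
      = ∫ x in Ω, ∫ q : ℝ × ℝ, ∑ i, ∑ j, M x i j • (∑ k, G j k q.1 x * G i k q.2 x)
        ∂(μ.prod μ) :=
    (integral_prod_symm _ (integrable_gradForm hM hG)).symm.trans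
      (integral_integral_swap (f := fun (q : ℝ × ℝ) (x : EuclideanSpace ℝ (Fin d)) =>
        ∑ i, ∑ j, M x i j • (∑ k, G j k q.1 x * G i k q.2 x)) (integrable_kernel hM hG))
  rw [h1]
  refine integral_nonneg_of_ae ?_
  have hGi : ∀ i k, ∀ᵐ x ∂(volume.restrict Ω), Integrable (fun t => G i k t x) μ := fun i k =>
    ((hG i k).integrable (by norm_num)).prod_left_ae
  filter_upwards [hM.posDef, ae_all_iff.2 fun i => ae_all_iff.2 (hGi i)] with x hx hGx
  have h2 : ∫ q : ℝ × ℝ, ∑ i, ∑ j, M x i j • (∑ k, G j k q.1 x * G i k q.2 x) ∂(μ.prod μ)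
      = ∑ k, quad (M x) (fun i => ∫ t, G i k t x ∂μ) := by
    have hint : ∀ i j k, Integrable (fun q : ℝ × ℝ => G j k q.1 x * G i k q.2 x) (μ.prod μ) :=
      fun i j k => (hGx j k).mul_prod (hGx i k)
    have h3 := sum_smul_sum_mul_conj hx (fun i k => ∫ t, G i k t x ∂μ)
    simp only [conj_trivial, RCLike.ofReal_real_eq_id, id] at h3
    have hint' : ∀ i j, Integrable (fun q : ℝ × ℝ =>
        M x i j • (∑ k, G j k q.1 x * G i k q.2 x)) (μ.prod μ) := fun i j =>
      (integrable_finsetSum _ fun k _ => hint i j k).const_mul (M x i j)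
    rw [← h3, integral_finsetSum _ fun i _ => integrable_finsetSum _ fun j _ => hint' i j]
    refine Finset.sum_congr rfl fun i _ => ?_
    rw [integral_finsetSum _ fun j _ => hint' i j]
    refine Finset.sum_congr rfl fun j _ => ?_
    rw [integral_smul, integral_finsetSum _ fun k _ => hint i j k]
    congr 1
    exact Finset.sum_congr rfl fun k _ =>
      integral_prod_mul (fun t => G j k t x) (fun t => G i k t x)
  rw [h2]
  exact Finset.sum_nonneg fun k _ => quad_nonneg hx _

end Kernel

section Stability

variable {d : ℕ} {Ω : Set (EuclideanSpace ℝ (Fin d))}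
  {A M : EuclideanSpace ℝ (Fin d) → Matrix (Fin 2) (Fin 2) ℝ}

/-- The solution at time `t` is itself an admissible test function, because the exceptional set of
times does not depend on the test function. The mixed mass terms are absorbed by `2 A ζ · ψ ≤ A ζ ·
ζ + A ψ · ψ`. -/
theorem IsLinearisedSolution.energy_le [IsFiniteMeasure (volume.restrict Ω)]
    (hA : IsPosDefField Ω A) (hM : IsPosDefField Ω M) {T : ℝ} (hT : 0 < T)
    {ζ₀ : Fin 2 → EuclideanSpace ℝ (Fin d) → ℝ} {ζ : Fin 2 → ℝ → EuclideanSpace ℝ (Fin d) → ℝ}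
    (h : IsLinearisedSolution Ω A M T ζ₀ ζ) :
    (∀ᵐ t ∂(volume.restrict (Ioo 0 T)), ∀ i, MemLp (ζ i t) 2 (volume.restrict Ω)) ∧
    ∀ᵐ t ∂(volume.restrict (Ioo 0 T)),
      massForm Ω A (fun i => ζ i t) (fun i => ζ i t) ≤ massForm Ω A ζ₀ ζ₀ := by
  obtain ⟨G, hG, hw⟩ := h.weak
  have hH1 : ∀ᵐ t ∂(volume.restrict (Ioo 0 T)), ∀ i, IsH1With Ω (ζ i t) (fun k => G i k t) :=
    ae_all_iff.2 fun i => (hG i).isH1With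
  have hGL : ∀ i k, MemLp (fun q : ℝ × EuclideanSpace ℝ (Fin d) => G i k q.1 q.2) 2
      ((volume.restrict (Ioo 0 T)).prod (volume.restrict Ω)) := fun i => (hG i).memLp_grad
  have hk := integrable_gradForm hM hGL
  refine ⟨hH1.mono fun t ht i => (ht i).memLp, ?_⟩
  have hki : ∀ᵐ t ∂(volume.restrict (Ioo 0 T)), IntervalIntegrable
      (fun σ => gradForm Ω M (fun i k => G i k σ) (fun i k => G i k t)) volume 0 T := by
    filter_upwards [hk.prod_left_ae] with t ht
    rwa [intervalIntegrable_iff_integrableOn_Ioo_of_le hT.le]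
  refine ae_le_of_energy_inequality hT
    (F := fun t => massForm Ω A (fun i => ζ i t) (fun i => ζ i t))
    (k := fun σ t => gradForm Ω M (fun i k => G i k σ) (fun i k => G i k t))
    ?_ hk (fun σ t => gradForm_symm hM _ _) ?_ ?_ ?_
  · rw [intervalIntegrable_iff_integrableOn_Ioo_of_le hT.le]
    exact integrable_massForm hA fun i => (hG i).memLp
  · intro s τ hs hsτ hτ
    have hsub : Ioc s τ ⊆ Ioo 0 T := fun t ht => ⟨hs.trans_lt ht.1, ht.2.trans_lt hτ⟩
    simp only [intervalIntegral.integral_of_le hsτ]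
    exact integral_gradForm_nonneg hM fun i k => (hGL i k).mono_measure
      (Measure.prod_mono (Measure.restrict_mono hsub le_rfl) le_rfl)
  · filter_upwards [hH1, hw] with t h1 h2
    have h3 := h2 (fun i => ζ i t) (fun i k => G i k t) h1
    have h4 := massForm_le hA h.initial fun i => (h1 i).memLp
    linarith
  -- The equations at `s` and at `t` are both tested with `ζ(t)`; their difference eliminates the
  -- initial value.
  · filter_upwards [hH1, hw, ae_restrict_mem measurableSet_Ioo] with s hs1 hs2 hsT
    filter_upwards [hH1, hw, hki, ae_restrict_mem measurableSet_Ioo] with t ht1 ht2 ht3 htT hst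
    have h1 := ht2 (fun i => ζ i t) (fun i k => G i k t) ht1
    have h2 := hs2 (fun i => ζ i t) (fun i k => G i k t) ht1
    have h3 := massForm_le hA (fun i => (hs1 i).memLp) fun i => (ht1 i).memLp
    have hsub : ∀ {u}, u ∈ Ioo 0 T → IntervalIntegrable
        (fun σ => gradForm Ω M (fun i k => G i k σ) (fun i k => G i k t)) volume 0 u :=
      fun {u} hu => ht3.mono_set (by
        rw [uIcc_of_le hu.1.le, uIcc_of_le hT.le]
        exact Icc_subset_Icc_right hu.2.le)
    have h4 := intervalIntegral.integral_interval_sub_left (hsub htT) (hsub hsT)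
    linarith

/-- A weak formulation with uniformly positive definite mass matrix is linearly stable. -/
theorem isLinearlyStable [IsFiniteMeasure (volume.restrict Ω)]
    (hA : IsPosDefField Ω A) (hM : IsPosDefField Ω M) {κ : ℝ} (hκ : 0 < κ)
    (hcoer : ∀ᵐ x ∂(volume.restrict Ω), ∀ y : Fin 2 → ℝ, κ * ∑ i, y i ^ 2 ≤ quad (A x) y) :
    IsLinearlyStable Ω A M := by
  obtain ⟨K, hK⟩ := hA.bdd
  have hsum : ∀ {f : Fin 2 → EuclideanSpace ℝ (Fin d) → ℝ},
      (∀ i, MemLp (f i) 2 (volume.restrict Ω)) →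
      IntegrableOn (fun x => ∑ i, f i x ^ 2) Ω ∧
        ∑ i, ∫ x in Ω, f i x ^ 2 = ∫ x in Ω, ∑ i, f i x ^ 2 := fun hf =>
    ⟨integrable_finsetSum _ fun i _ => (hf i).integrable_sq,
      (integral_finsetSum _ fun i _ => (hf i).integrable_sq).symm⟩
  -- Entries bounded by `|K|` bound the form of a 2 × 2 matrix by `2 |K|` times the square norm; the
  -- `+ 1` only keeps the constant positive.
  refine ⟨(2 * |K| + 1) / κ, by positivity, fun T hT ζ₀ ζ h => ?_⟩
  obtain ⟨hL, hle⟩ := h.energy_le hA hM hT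
  filter_upwards [hL, hle] with t ht htle
  rw [(hsum ht).2, (hsum h.initial).2, div_mul_eq_mul_div, le_div_iff₀ hκ, mul_comm _ κ]
  rw [massForm_self, massForm_self] at htle
  have h1 : κ * ∫ x in Ω, ∑ i, ζ i t x ^ 2 ≤ ∫ x in Ω, quad (A x) (fun i => ζ i t x) := by
    rw [← integral_const_mul]
    exact integral_mono_ae ((hsum ht).1.const_mul κ) (integrable_quad hA ht)
      (hcoer.mono fun x hx => hx _)
  have h2 : ∫ x in Ω, quad (A x) (fun i => ζ₀ i x)
      ≤ (2 * |K| + 1) * ∫ x in Ω, ∑ i, ζ₀ i x ^ 2 := by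
    rw [← integral_const_mul]
    refine integral_mono_ae (integrable_quad hA h.initial)
      ((hsum h.initial).1.const_mul _) (hK.mono fun x hx => ?_)
    have h3 : ∀ i j, A x i j * (ζ₀ j x * ζ₀ i x) ≤ |K| * ((ζ₀ j x ^ 2 + ζ₀ i x ^ 2) / 2) := by
      intro i j
      refine (le_abs_self _).trans ?_
      rw [abs_mul]
      refine mul_le_mul ((hx i j).trans (le_abs_self K)) ?_ (abs_nonneg _) (abs_nonneg _)
      rw [abs_le]
      constructor <;> nlinarith [sq_nonneg (ζ₀ j x + ζ₀ i x), sq_nonneg (ζ₀ j x - ζ₀ i x)]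
    simp only [quad_real, Fin.sum_univ_two]
    nlinarith [h3 0 0, h3 0 1, h3 1 0, h3 1 1, sq_nonneg (ζ₀ 0 x), sq_nonneg (ζ₀ 1 x)]
  linarith

end Stability

/-! ### Coefficients and bounds at a stationary solution -/

section Stationary

variable {d : ℕ} {Ω : Set (EuclideanSpace ℝ (Fin d))} {ε : ℝ}
  {Vr Vb r b : EuclideanSpace ℝ (Fin d) → ℝ} {Nr Nb : ℝ}

theorem IsStationarySolution.ae_pos (h : IsStationarySolution Ω ε Vr Vb Nr Nb r b) :
    ∀ᵐ x ∂(volume.restrict Ω), 0 < r x ∧ 0 < b x ∧ r x + b x < 1 / gammaBar d ε :=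
  h.interior.mono fun _ hx => of_mem_interior_stateSet hx

theorem IsStationarySolution.mobilityField_isPosDefField (hc : 0 < gammaBar d ε)
    (h : IsStationarySolution Ω ε Vr Vb Nr Nb r b) :
    IsPosDefField Ω (mobilityField ε r b) where
  meas i j := by
    have hr := h.density.meas_r
    have hb := h.density.meas_b
    have h1 := hr.mul (aestronglyMeasurable_const (b := (1 : ℝ)).sub (hb.const_mul (gammaBar d ε)))
    have h2 := hb.mul (aestronglyMeasurable_const (b := (1 : ℝ)).sub (hr.const_mul (gammaBar d ε)))
    have h3 := (hr.const_mul (gammaBar d ε)).mul hb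
    fin_cases i <;> fin_cases j
    exacts [h1, h3, h3, h2]
  bdd := ⟨1 / gammaBar d ε, h.ae_pos.mono fun x hx i j =>
    abs_mobility_le hc hx.1 hx.2.1 hx.2.2 (by linarith) (by linarith) i j⟩
  posDef := h.ae_pos.mono fun x hx => mobility_posDef hc hx.1 hx.2.1 hx.2.2

theorem IsStationarySolution.dualHessField_eq (ha : 0 < alphaBar d ε)
    (h : IsStationarySolution Ω ε Vr Vb Nr Nb r b) :
    ∀ᵐ x ∂(volume.restrict Ω),
      dualHessField ε Vr Vb r b x = invHess (alphaBar d ε) (r x) (b x) :=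
  h.ae_pos.mono fun x hx => dualEntropyHess_eq ha hx.1 hx.2.1 (Vr x) (Vb x)

theorem IsStationarySolution.dualHessField_isPosDefField (ha : 0 < alphaBar d ε)
    (h : IsStationarySolution Ω ε Vr Vb Nr Nb r b) :
    IsPosDefField Ω (dualHessField ε Vr Vb r b) where
  meas i j := by
    have hr := h.density.meas_r.aemeasurable
    have hb := h.density.meas_b.aemeasurable
    refine AEStronglyMeasurable.congr (f := fun x => invHess (alphaBar d ε) (r x) (b x) i j) ?_
      ((h.dualHessField_eq ha).mono fun x hx => (congrFun₂ hx i j).symm)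
    refine AEMeasurable.aestronglyMeasurable ?_
    fin_cases i <;> fin_cases j <;> simp only [invHess, Fin.zero_eta, Fin.mk_one,
      Matrix.of_apply, Matrix.cons_val_zero, Matrix.cons_val_one, Matrix.cons_val',
      Matrix.cons_val_fin_one] <;> fun_prop
  bdd := by
    refine ⟨1 / gammaBar d ε, ?_⟩
    filter_upwards [h.ae_pos, h.dualHessField_eq ha] with x hx hx' i j
    rw [hx']
    exact abs_invHess_le ha hx.1 hx.2.1 (by linarith) (by linarith) i j
  posDef := by
    filter_upwards [h.ae_pos, h.dualHessField_eq ha] with x hx hx'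
    rw [hx']
    exact invHess_posDef ha hx.1 hx.2.1

/-- The entropy variables are in `H¹`, so they may be used as test functions; the dissipation is
then zero and positivity of the mobility kills the gradients. -/
theorem IsStationarySolution.entropyFields_const (hΩ : IsOpen Ω) (hconn : IsConnected Ω)
    [IsFiniteMeasure (volume.restrict Ω)] (hc : 0 < gammaBar d ε)
    (h : IsStationarySolution Ω ε Vr Vb Nr Nb r b) :
    ∃ c : Fin 2 → ℝ, ∀ i, ∀ᵐ x ∂(volume.restrict Ω), entropyFields ε Vr Vb r b i x = c i := by
  obtain ⟨G, hG, hw⟩ := h.weak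
  have hM := h.mobilityField_isPosDefField hc
  have h0 := hw _ _ hG
  have h1 := gradForm_conj hM G
  simp only [conj_trivial, RCLike.ofReal_real_eq_id, id] at h1
  change gradForm Ω (mobilityField ε r b) G G = _ at h1
  rw [h0] at h1
  have hG0 := ae_eq_zero_of_integral_sum_quad hM (fun i k => (hG i).memLp_grad k) h1.symm
  choose c hc' using fun i => (hG i).ae_const hΩ hconn (hG0 i)
  exact ⟨c, hc'⟩

theorem exists_ae_abs_le {V : EuclideanSpace ℝ (Fin d) → ℝ}
    (hV : MemLp V ⊤ (volume.restrict Ω)) :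
    ∃ C : ℝ, ∀ᵐ x ∂(volume.restrict Ω), |V x| ≤ C := by
  have hfin : eLpNormEssSup V (volume.restrict Ω) ≠ ⊤ := by
    rw [← eLpNorm_exponent_top]
    exact hV.2.ne
  refine ⟨(eLpNormEssSup V (volume.restrict Ω)).toReal, ?_⟩
  filter_upwards [ae_le_eLpNormEssSup (f := V) (μ := volume.restrict Ω)] with x hx
  have := ENNReal.toReal_mono hfin hx
  rwa [toReal_enorm] at this

/-- From `log r = c 0 - ᾱ (r + b) - V_r`, with `r + b` and `V_r` bounded, `log r` is bounded below;
likewise for `b`. -/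
theorem IsStationarySolution.exists_lower_bound (ha : 0 < alphaBar d ε)
    (hVr : MemLp Vr ⊤ (volume.restrict Ω)) (hVb : MemLp Vb ⊤ (volume.restrict Ω))
    (h : IsStationarySolution Ω ε Vr Vb Nr Nb r b) {c : Fin 2 → ℝ}
    (hc : ∀ i, ∀ᵐ x ∂(volume.restrict Ω), entropyFields ε Vr Vb r b i x = c i) :
    ∃ m > 0, ∀ᵐ x ∂(volume.restrict Ω), m ≤ r x ∧ m ≤ b x := by
  obtain ⟨Cr, hCr⟩ := exists_ae_abs_le hVr
  obtain ⟨Cb, hCb⟩ := exists_ae_abs_le hVb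
  refine ⟨min (Real.exp (c 0 - alphaBar d ε * (1 / gammaBar d ε) - Cr))
    (Real.exp (c 1 - alphaBar d ε * (1 / gammaBar d ε) - Cb)),
    lt_min (Real.exp_pos _) (Real.exp_pos _), ?_⟩
  filter_upwards [h.ae_pos, hc 0, hc 1, hCr, hCb] with x hx h0 h1 hr hb
  have hs := mul_le_mul_of_nonneg_left hx.2.2.le ha.le
  have h0' : Real.log (r x) + alphaBar d ε * (r x + b x) + Vr x = c 0 := h0
  have h1' : Real.log (b x) + alphaBar d ε * (r x + b x) + Vb x = c 1 := h1
  have hr' := (abs_le.1 hr).2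
  have hb' := (abs_le.1 hb).2
  exact ⟨(min_le_left _ _).trans ((Real.le_log_iff_exp_le hx.1).1 (by linarith)),
    (min_le_right _ _).trans ((Real.le_log_iff_exp_le hx.2.1).1 (by linarith))⟩

theorem IsStationarySolution.linearlyStable [IsFiniteMeasure (volume.restrict Ω)]
    (ha : 0 < alphaBar d ε) (hγ : 0 < gammaBar d ε)
    (hVr : MemLp Vr ⊤ (volume.restrict Ω)) (hVb : MemLp Vb ⊤ (volume.restrict Ω))
    (h : IsStationarySolution Ω ε Vr Vb Nr Nb r b) {c : Fin 2 → ℝ}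
    (hc : ∀ i, ∀ᵐ x ∂(volume.restrict Ω), entropyFields ε Vr Vb r b i x = c i) :
    IsLinearlyStable Ω (dualHessField ε Vr Vb r b) (mobilityField ε r b) := by
  obtain ⟨m, hm, hmle⟩ := h.exists_lower_bound ha hVr hVb hc
  refine isLinearlyStable (h.dualHessField_isPosDefField ha) (h.mobilityField_isPosDefField hγ)
    (κ := m / (1 + alphaBar d ε * (1 / gammaBar d ε + 1 / gammaBar d ε))) (by positivity) ?_
  filter_upwards [h.ae_pos, h.dualHessField_eq ha, hmle] with x hx hx' hxm y
  rw [hx', quad_real]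
  exact invHess_coercive ha hx.1 hx.2.1 hm.le hxm.1 hxm.2 (by linarith) (by linarith) y

end Stationary

end HardSpheres

/-! ### The main theorem -/

theorem mainTheorem5 (d : ℕ) (hd : d = 2 ∨ d = 3)
    (Ω : Set (EuclideanSpace ℝ (Fin d)))
    (hΩ_open : IsOpen Ω) (hΩ_conn : IsConnected Ω) (hΩ_bdd : Bornology.IsBounded Ω)
    (ε : ℝ) (hε : 0 < ε)
    (Vr Vb : EuclideanSpace ℝ (Fin d) → ℝ)
    (hVr : HardSpheres.MemH1 Ω Vr) (hVr_bdd : MemLp Vr ⊤ (volume.restrict Ω))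
    (hVb : HardSpheres.MemH1 Ω Vb) (hVb_bdd : MemLp Vb ⊤ (volume.restrict Ω)) :
    -- strict convexity of the entropy
    (∀ r₁ b₁ r₂ b₂ : EuclideanSpace ℝ (Fin d) → ℝ,
      HardSpheres.IsDensityPair Ω ε r₁ b₁ → HardSpheres.IsDensityPair Ω ε r₂ b₂ →
      ¬ (r₁ =ᵐ[volume.restrict Ω] r₂ ∧ b₁ =ᵐ[volume.restrict Ω] b₂) →
      ∀ s ∈ Ioo (0 : ℝ) 1,
        HardSpheres.entropy Ω ε Vr Vb (fun x => (1 - s) * r₁ x + s * r₂ x)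
            (fun x => (1 - s) * b₁ x + s * b₂ x)
          < (1 - s) * HardSpheres.entropy Ω ε Vr Vb r₁ b₁
            + s * HardSpheres.entropy Ω ε Vr Vb r₂ b₂) ∧
    -- uniqueness of the stationary solution with given masses
    (∀ (Nr Nb : ℝ) (r b r' b' : EuclideanSpace ℝ (Fin d) → ℝ),
      HardSpheres.IsStationarySolution Ω ε Vr Vb Nr Nb r b →
      HardSpheres.IsStationarySolution Ω ε Vr Vb Nr Nb r' b' →
      r =ᵐ[volume.restrict Ω] r' ∧ b =ᵐ[volume.restrict Ω] b') ∧
    ∀ (Nr Nb : ℝ) (r b : EuclideanSpace ℝ (Fin d) → ℝ),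
      HardSpheres.IsStationarySolution Ω ε Vr Vb Nr Nb r b →
      -- the entropy variables are constant
      (∃ c : Fin 2 → ℝ, ∀ i, ∀ᵐ x ∂(volume.restrict Ω),
        HardSpheres.entropyFields ε Vr Vb r b i x = c i) ∧
      -- the stationary solution is the unique minimizer of the entropy under the constraints
      (∀ r' b' : EuclideanSpace ℝ (Fin d) → ℝ, HardSpheres.IsDensityPair Ω ε r' b' →
        HardSpheres.HasMasses Ω Nr Nb r' b' →
        HardSpheres.entropy Ω ε Vr Vb r b ≤ HardSpheres.entropy Ω ε Vr Vb r' b' ∧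
        (HardSpheres.entropy Ω ε Vr Vb r' b' = HardSpheres.entropy Ω ε Vr Vb r b →
          r' =ᵐ[volume.restrict Ω] r ∧ b' =ᵐ[volume.restrict Ω] b)) ∧
      -- the coefficients of the linearised problem are positive definite
      (∀ᵐ x ∂(volume.restrict Ω), (HardSpheres.dualHessField ε Vr Vb r b x).PosDef ∧
        (HardSpheres.mobilityField ε r b x).PosDef) ∧
      -- the eigenvalues of the linearised problem are real and negative
      (∀ (lam : ℂ) (ζ : Fin 2 → EuclideanSpace ℝ (Fin d) → ℂ),
        HardSpheres.IsEigenpair Ω (HardSpheres.dualHessField ε Vr Vb r b)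
          (HardSpheres.mobilityField ε r b) lam ζ →
        lam.im = 0 ∧ lam.re ≤ 0 ∧
        (lam = 0 ↔ ∃ c : Fin 2 → ℂ, ∀ i, ∀ᵐ x ∂(volume.restrict Ω), ζ i x = c i) ∧
        (HardSpheres.IsMassPreserving Ω (HardSpheres.dualHessField ε Vr Vb r b) ζ →
          lam.re < 0)) ∧
      -- perturbations evolving by the linearised problem stay small
      HardSpheres.IsLinearlyStable Ω (HardSpheres.dualHessField ε Vr Vb r b)
        (HardSpheres.mobilityField ε r b) := by
  have hd2 : 2 ≤ d := by rcases hd with rfl | rfl <;> norm_num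
  have ha := HardSpheres.alphaBar_pos hd2 hε
  have hγ := HardSpheres.gammaBar_pos hd2 hε
  have : IsFiniteMeasure (volume.restrict Ω) :=
    isFiniteMeasure_restrict.2 hΩ_bdd.measure_lt_top.ne
  have hVri : IntegrableOn Vr Ω := hVr_bdd.integrable le_top
  have hVbi : IntegrableOn Vb Ω := hVb_bdd.integrable le_top
  have hmin : ∀ {Nr Nb : ℝ} {r b r' b' : EuclideanSpace ℝ (Fin d) → ℝ},
      HardSpheres.IsStationarySolution Ω ε Vr Vb Nr Nb r b →
      HardSpheres.IsDensityPair Ω ε r' b' → HardSpheres.HasMasses Ω Nr Nb r' b' →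
        HardSpheres.entropy Ω ε Vr Vb r b ≤ HardSpheres.entropy Ω ε Vr Vb r' b' ∧
        (HardSpheres.entropy Ω ε Vr Vb r' b' = HardSpheres.entropy Ω ε Vr Vb r b →
          r' =ᵐ[volume.restrict Ω] r ∧ b' =ᵐ[volume.restrict Ω] b) := by
    intro Nr Nb r b r' b' h h' hm'
    obtain ⟨c, hc⟩ := h.entropyFields_const hΩ_open hΩ_conn hγ
    exact HardSpheres.entropy_minimizer ha hVri hVbi h.density h'
      (h.ae_pos.mono fun x hx => ⟨hx.1, hx.2.1⟩) h.masses hm' hc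
  refine ⟨fun r₁ b₁ r₂ b₂ h₁ h₂ hne s hs =>
    HardSpheres.entropy_strictConvex ha hVri hVbi h₁ h₂ hne hs,
    fun Nr Nb r b r' b' h h' => ?_, fun Nr Nb r b h => ?_⟩
  -- Each stationary solution minimizes the entropy at the same masses, so the two entropies are
  -- equal and the equality case identifies the densities.
  · have h1 := hmin h' h.density h.masses
    have h2 := hmin h h'.density h'.masses
    exact h1.2 (le_antisymm h2.1 h1.1)
  · obtain ⟨c, hc⟩ := h.entropyFields_const hΩ_open hΩ_conn hγ
    have hA := h.dualHessField_isPosDefField ha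
    have hM := h.mobilityField_isPosDefField hγ
    exact ⟨⟨c, hc⟩, fun r' b' h' hm' => hmin h h' hm', hA.posDef.and hM.posDef,
      fun lam ζ hζ => hζ.eigenvalue hΩ_open hΩ_conn hA hM,
      h.linearlyStable ha hγ hVr_bdd hVb_bdd hc⟩
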